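/- **Theorem (Minimum dissipation theorem).** Let $\Omega\subset\mathbb R^{n}$ be a bounded open set with piecewise smooth boundary: $\partial\Omega$ is a $C^1$ hypersurface with $\Omega$ on one side of it, with unit outward normal $\widehat{\mathbf n}$, except for a set $S$ of edges and corners of finite $(n-2)$-dimensional Hausdorff measure (so $S=\emptyset$ if $n=1$ and $S$ is finite if $n=2$). Let $\mu,\beta,\gamma>0$ be constants and, for $i=1,2$, let $\phi_i>0$ be scalar fields and $\mathbf K_i$ fields of symmetric positive definite $n\times n$ matrices on $\Omega$; put $\alpha_i=\mu\phi_i^2\mathbf K_i^{-1}$. Let $v_{n1},v_{n2}$ be given functions on $\partial\Omega$ and let $\mathbf b$ be a body force that is conservative, i.e. $\gamma\mathbf b=-\mathrm{grad}[\psi]$ in $\Omega$ for some $\psi\in C^1(\Omega)$. Consider pairs of velocity fields $(\mathbf w_1,\mathbf w_2)$ such that each $\phi_i\mathbf w_i$ is $C^1$ in $\Omega$ and continuous on $\Omega\cup(\partial\Omega\setminus S)$, the fields $\phi_i\mathbf w_i$ and $\mathrm{div}[\phi_i\mathbf w_i]$ are square integrable on $\Omega$, and $\alpha_i\mathbf w_i\cdot\mathbf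 w_i$ is integrable on $\Omega$. For such pairs let $$\Phi[\mathbf w_1,\mathbf w_2]=\sum_{i=1}^2\Big(\int_\Omega\alpha_i\mathbf w_i\cdot\mathbf w_i\,d\Omega+\frac12\int_\Omega\frac{\mu}{\beta}\big(\mathrm{div}[\phi_i\mathbf w_i]\big)^2d\Omega\Big).$$ Such a pair is called kinematically admissible if $\mathrm{div}[\phi_1\mathbf w_1]+\mathrm{div}[\phi_2\mathbf w_2]=0$ in $\Omega$ and $\mathbf w_i\cdot\widehat{\mathbf n}=v_{ni}$ on $\partial\Omega\setminus S$ for $i=1,2$. Let $(\mathbf v_1,\mathbf v_2)$ be a pair of true velocity fields for the double porosity/permeability model with velocity boundary conditions on the whole boundary, i.e. a pair of this class for which there are pressures $p_1,p_2\in C^1(\Omega)$ with $$\alpha_i\mathbf v_i+\phi_i\,\mathrm{grad}[p_i]=\phi_i\gamma\mathbf b\quad(i=1,2),\qquad \mathrm{div}[\phi_1\mathbf v_1]=\chi,\qquad \mathrm{div}[\phi_2\mathbf v_2]=-\chi,\qquad \chi=-\frac{\beta}{\mu}(p_1-p_2)$$ in $\Omega$ and $\mathbf v_i\cdot\widehat{\mathbf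 n}=v_{ni}$ on $\partial\Omega\setminus S$ $(i=1,2)$. Then $(\mathbf v_1,\mathbf v_2)$ is kinematically admissible, and every kinematically admissible pair $(\widetilde{\mathbf v}_1,\widetilde{\mathbf v}_2)$ satisfies $$\Phi[\mathbf v_1,\mathbf v_2]\le\Phi[\widetilde{\mathbf v}_1,\widetilde{\mathbf v}_2].$$ -/

import Mathlib

open MeasureTheory Set
open scoped RealInnerProductSpace

noncomputable section

namespace DoublePorosity

/-- Euclidean space of dimension `n`. -/
abbrev E (n : ℕ) : Type := EuclideanSpace ℝ (Fin n)

/-- The divergence of a vector field. -/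
def divergence {n : ℕ} (F : E n → E n) (x : E n) : ℝ :=
  ∑ j : Fin n, (fderiv ℝ F x (EuclideanSpace.single j 1)) j

/-- `ν` is the unit outward normal to `∂Ω` at the boundary point `x`: near `x` the boundary is a
`C¹` hypersurface with `Ω` on one side of it, i.e. `Ω` is, near `x`, the sublevel set `{ρ < 0}` of
a `C¹` function `ρ` with `grad ρ (x) ≠ 0`, and `ν = grad ρ (x) / |grad ρ (x)|`. -/
def IsOutwardUnitNormal {n : ℕ} (Ω : Set (E n)) (x ν : E n) : Prop :=
  x ∈ frontier Ω ∧ ∃ (U : Set (E n)) (ρ : E n → ℝ), IsOpen U ∧ x ∈ U ∧ ContDiffOn ℝ 1 ρ U ∧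
    Ω ∩ U = {y ∈ U | ρ y < 0} ∧ gradient ρ x ≠ 0 ∧ ν = ‖gradient ρ x‖⁻¹ • gradient ρ x

/-- The regular part of `∂Ω`: the boundary points at which there is a unit outward normal. -/
def regularBoundary {n : ℕ} (Ω : Set (E n)) : Set (E n) :=
  {x | ∃ ν, IsOutwardUnitNormal Ω x ν}

/-- The boundary of `Ω` is piecewise smooth: it is a `C¹` hypersurface with `Ω` on one side, except
for a set of edges and corners whose `(n - 2)`-dimensional Hausdorff measure is finite
(finitely many corners if `n = 2`, edges of finite total length if `n = 3`, no exceptional points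
if `n = 1`). -/
def HasPiecewiseSmoothBoundary {n : ℕ} (Ω : Set (E n)) : Prop :=
  μH[(n : ℝ) - 2] (frontier Ω \ regularBoundary Ω) < ⊤

/-- The data of the boundary value problem of the double porosity/permeability model. The index
`i : Fin 2` refers to the pore-network: `0` is the macro-pore and `1` the micro-pore network. -/
structure Problem (n : ℕ) where
  /-- the domain -/
  Ω : Set (E n)
  isOpen_Ω : IsOpen Ω
  isBounded_Ω : Bornology.IsBounded Ω
  piecewiseSmooth_Ω : HasPiecewiseSmoothBoundary Ω
  /-- the viscosity of the fluid -/
  μ : ℝ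
  /-- the mass transfer parameter of the porous medium -/
  β : ℝ
  /-- the true density of the fluid -/
  γ : ℝ
  μ_pos : 0 < μ
  β_pos : 0 < β
  γ_pos : 0 < γ
  /-- the porosities (volume fractions) -/
  φ : Fin 2 → E n → ℝ
  φ_pos : ∀ i, ∀ x ∈ Ω, 0 < φ i x
  /-- the permeability tensors, symmetric and positive definite -/
  K : Fin 2 → E n → Matrix (Fin n) (Fin n) ℝ
  K_posDef : ∀ i, ∀ x ∈ Ω, (K i x).PosDef
  /-- the specific body force -/
  b : E n → E n
  /-- the part of the boundary where the normal velocity is prescribed -/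
  Γv : Fin 2 → Set (E n)
  /-- the part of the boundary where the pressure is prescribed -/
  Γp : Fin 2 → Set (E n)
  Γ_union : ∀ i, Γv i ∪ Γp i = frontier Ω
  Γ_disjoint : ∀ i, Disjoint (Γv i) (Γp i)
  /-- the prescribed normal velocities -/
  vn : Fin 2 → E n → ℝ
  /-- the prescribed pressures -/
  p₀ : Fin 2 → E n → ℝ

namespace Problem

variable {n : ℕ} (D : Problem n)

/-- The bulk densities `ρᵢ = φᵢ γ`. -/
def bulkDensity (i : Fin 2) (x : E n) : ℝ := D.φ i x * D.γ

/-- The drag tensors `αᵢ = μ φᵢ² Kᵢ⁻¹`. -/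
def α (i : Fin 2) (x : E n) : Matrix (Fin n) (Fin n) ℝ :=
  (D.μ * D.φ i x ^ 2) • (D.K i x)⁻¹

/-- The drag `αᵢ w` at the point `x`. -/
def drag (i : Fin 2) (x w : E n) : E n := Matrix.toEuclideanLin (D.α i x) w

/-- The discharge velocity `φᵢ w` of a field `w` of true velocities. -/
def discharge (i : Fin 2) (w : E n → E n) (x : E n) : E n := D.φ i x • w x

/-- The velocity fields of the `i`-th network: the discharge velocity is continuously
differentiable in `Ω` and continuous up to the regular part of the boundary portion where the
normal velocity is prescribed; the discharge velocity and its divergence are square integrable,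
and the rate of dissipation `αᵢ w · w` is integrable. -/
structure IsVelocityField (i : Fin 2) (w : E n → E n) : Prop where
  contDiffOn : ContDiffOn ℝ 1 (D.discharge i w) D.Ω
  continuousOn : ContinuousOn (D.discharge i w) (D.Ω ∪ (D.Γv i ∩ regularBoundary D.Ω))
  memLp : MemLp (D.discharge i w) 2 (volume.restrict D.Ω)
  memLp_div : MemLp (divergence (D.discharge i w)) 2 (volume.restrict D.Ω)
  integrableOn : IntegrableOn (fun x => ⟪D.drag i x (w x), w x⟫) D.Ω

/-- The normal component of `w` takes the prescribed values on `Γᵢᵛ` (wherever the boundary has a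
normal). -/
def HasNormalVelocity (i : Fin 2) (w : E n → E n) : Prop :=
  ∀ x ∈ D.Γv i, ∀ ν, IsOutwardUnitNormal D.Ω x ν → ⟪w x, ν⟫ = D.vn i x

/-- The pressure fields of the `i`-th network: continuously differentiable in `Ω` and continuous
up to the boundary portion where the pressure is prescribed. -/
structure IsPressureField (i : Fin 2) (p : E n → ℝ) : Prop where
  contDiffOn : ContDiffOn ℝ 1 p D.Ω
  continuousOn : ContinuousOn p (D.Ω ∪ D.Γp i)

/-- The mass transfer `χ = -(β/μ) (p₁ - p₂)`. -/
def massTransfer (p : Fin 2 → E n → ℝ) (x : E n) : ℝ := -(D.β / D.μ) * (p 0 x - p 1 x)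

/-- The governing equations of the double porosity/permeability model. -/
structure IsSolution (v : Fin 2 → E n → E n) (p : Fin 2 → E n → ℝ) : Prop where
  velocity : ∀ i, D.IsVelocityField i (v i)
  pressure : ∀ i, D.IsPressureField i (p i)
  momentum : ∀ i, ∀ x ∈ D.Ω,
    D.drag i x (v i x) + D.φ i x • gradient (p i) x = D.bulkDensity i x • D.b x
  mass_macro : ∀ x ∈ D.Ω, divergence (D.discharge 0 (v 0)) x = D.massTransfer p x
  mass_micro : ∀ x ∈ D.Ω, divergence (D.discharge 1 (v 1)) x = -D.massTransfer p x
  normal_velocity : ∀ i, D.HasNormalVelocity i (v i)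
  boundary_pressure : ∀ i, ∀ x ∈ D.Γp i, p i x = D.p₀ i x

/-- `(v 0, v 1)` is the pair of true velocity fields: together with some pressures it satisfies
all the governing equations. -/
def IsTrueVelocityPair (v : Fin 2 → E n → E n) : Prop := ∃ p, D.IsSolution v p

/-- The body force is conservative: `γ b = -grad ψ` in `Ω` for some scalar field `ψ`. -/
def HasConservativeBodyForce : Prop :=
  ∃ ψ : E n → ℝ, ContDiffOn ℝ 1 ψ D.Ω ∧ ∀ x ∈ D.Ω, D.γ • D.b x = -gradient ψ x

/-- Kinematically admissible pairs. -/
structure IsKinematicallyAdmissible (w : Fin 2 → E n → E n) : Prop where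
  velocity : ∀ i, D.IsVelocityField i (w i)
  mass : ∀ x ∈ D.Ω,
    divergence (D.discharge 0 (w 0)) x + divergence (D.discharge 1 (w 1)) x = 0
  normal_velocity : ∀ i, D.HasNormalVelocity i (w i)

/-- The dissipation functional `Φ`. -/
def dissipation (w : Fin 2 → E n → E n) : ℝ :=
  ∑ i : Fin 2, ((∫ x in D.Ω, ⟪D.drag i x (w i x), w i x⟫) +
    1 / 2 * ∫ x in D.Ω, D.μ / D.β *
      (divergence (D.discharge i (w i)) x * divergence (D.discharge i (w i)) x))

end Problem

end DoublePorosity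

end

namespace DoublePorosity

open Filter Topology
open scoped ENNReal

variable {n : ℕ}

/-! The functional is a convex quadratic, so it suffices that its first variation at the true pair
`v` vanishes towards every admissible `w`. Put `u i = φ i • (w i - v i)` and `q i = p i + ψ`. The
momentum balance says that the drag of `v i` is `-φ i • grad (q i)`, so the cross term `⟪drag v i, w
i - v i⟫` is `-dq i (u i)`. The fields `u 0`, `u 1` have opposite divergences and no normal
component on the boundary, so integration by parts turns the sum of the cross terms into `∫ (q 0 - q
1) div (u 0)`. The mass transfer law makes this `-(μ/β) ∫ dv (dw - dv)`, where `dv`, `dw` are the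
divergences of the macro-pore discharges. That is exactly minus the cross term of the divergence
part of `Φ`.

The work lies in the integration by parts (`integral_pressure_power_eq_zero`), since the pressures
need not be bounded or extend to the boundary, the fields are only square integrable, and the
boundary has edges and corners. The flux is treated weakly: `fluxPairing Ω F η` vanishes for `η`
supported inside `Ω` (`fluxPairing_eq_zero_of_tsupport_subset`), for `η` supported near a regular
boundary point when `F` is a bounded multiple of a continuous tangential field
(`exists_ball_fluxPairing_eq_zero`), hence for all `η` supported off the singular set. That set has
finite `(n - 2)`-dimensional measure, so it can be cut out with bounded Dirichlet energy on sets of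
arbitrarily small volume (`exists_cutoff`), which a square integrable field does not notice.
Unbounded pressures are reached by a smooth truncation that is then released. -/

/-! ### Weak boundary flux: interior test functions and localisation. -/

/-- The weak form `∫_Ω (η div F + dη F)` of the flux of `η F` through the boundary of `Ω`. -/
noncomputable def fluxPairing (Ω : Set (E n)) (F : E n → E n) (η : E n → ℝ) : ℝ :=
  ∫ x in Ω, (η x * divergence F x + fderiv ℝ η x (F x))

theorem integrableOn_mul_of_continuous {Ω : Set (E n)} (hΩo : IsOpen Ω)
    (hΩ : Bornology.IsBounded Ω)
    {f η : E n → ℝ} (hf : IntegrableOn f Ω) (hη : Continuous η) :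
    IntegrableOn (fun x => η x * f x) Ω := by
  obtain ⟨M, hM⟩ := hΩ.isCompact_closure.exists_bound_of_continuousOn hη.continuousOn
  refine hf.bdd_mul (c := M) hη.aestronglyMeasurable ?_
  exact (ae_restrict_iff' hΩo.measurableSet).2 (.of_forall fun x hx => hM x (subset_closure hx))

theorem integrableOn_fderiv_apply {Ω : Set (E n)} (hΩo : IsOpen Ω)
    (hΩ : Bornology.IsBounded Ω)
    {F : E n → E n} {η : E n → ℝ} (hF : IntegrableOn F Ω) (hη : ContDiff ℝ 1 η) :
    IntegrableOn (fun x => fderiv ℝ η x (F x)) Ω := by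
  have hc := hη.continuous_fderiv one_ne_zero
  obtain ⟨M, hM⟩ := hΩ.isCompact_closure.exists_bound_of_continuousOn hc.continuousOn
  refine (hF.norm.const_mul M).mono'
    (isBoundedBilinearMap_apply.continuous.comp_aestronglyMeasurable
      (hc.aestronglyMeasurable.prodMk hF.aestronglyMeasurable)) ?_
  refine (ae_restrict_iff' hΩo.measurableSet).2 (.of_forall fun x hx => ?_)
  exact (ContinuousLinearMap.le_opNorm _ _).trans
    (mul_le_mul_of_nonneg_right (hM x (subset_closure hx)) (norm_nonneg _))

theorem fluxPairing_add {Ω : Set (E n)} (hΩo : IsOpen Ω) (hΩ : Bornology.IsBounded Ω)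
    {F : E n → E n} (hF : IntegrableOn F Ω) (hdiv : IntegrableOn (divergence F) Ω)
    {η θ : E n → ℝ} (hη : ContDiff ℝ 1 η) (hθ : ContDiff ℝ 1 θ) :
    fluxPairing Ω F (fun x => η x + θ x) = fluxPairing Ω F η + fluxPairing Ω F θ := by
  unfold fluxPairing
  rw [← integral_add]
  · congr 1
    ext x
    rw [fderiv_fun_add (hη.differentiable one_ne_zero x) (hθ.differentiable one_ne_zero x)]
    simp only [add_apply]
    ring
  · exact (integrableOn_mul_of_continuous hΩo hΩ hdiv hη.continuous).add
      (integrableOn_fderiv_apply hΩo hΩ hF hη)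
  · exact (integrableOn_mul_of_continuous hΩo hΩ hdiv hθ.continuous).add
      (integrableOn_fderiv_apply hΩo hΩ hF hθ)

theorem fluxPairing_eq_zero_of_disjoint {Ω : Set (E n)}
    {F : E n → E n} {η : E n → ℝ} (h : ∀ x ∈ Ω, x ∉ tsupport η) : fluxPairing Ω F η = 0 := by
  refine setIntegral_eq_zero_of_forall_eq_zero fun x hx => ?_
  rw [fderiv_of_notMem_tsupport ℝ (h x hx), image_eq_zero_of_notMem_tsupport (h x hx)]
  simp

theorem continuousOn_fderiv_apply {Ω : Set (E n)} (hΩo : IsOpen Ω)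
    {F : E n → E n} (hF : ContDiffOn ℝ 1 F Ω) (v : E n) :
    ContinuousOn (fun x => fderiv ℝ F x v) Ω :=
  (hF.continuousOn_fderiv_of_isOpen hΩo le_rfl).clm_apply continuousOn_const

theorem continuous_mul_of_tsupport_subset {Ω : Set (E n)} (hΩo : IsOpen Ω) {η f : E n → ℝ}
    (hη : Continuous η) (hf : ContinuousOn f Ω) (h : tsupport η ⊆ Ω) :
    Continuous (fun x => η x * f x) := by
  refine continuous_of_tsupport fun x hx => ?_
  have hx' : x ∈ Ω := h (tsupport_mul_subset_left hx)
  exact hη.continuousAt.mul (hf.continuousAt (hΩo.mem_nhds hx'))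

/-- Every product of `η`, or of a derivative of `η`, with a component of `F` or its derivatives
extends continuously by zero with compact support. Integration by parts on the whole space, one
coordinate at a time, then needs no boundary. -/
theorem fluxPairing_eq_zero_of_tsupport_subset {Ω : Set (E n)} (hΩo : IsOpen Ω)
    (hΩ : Bornology.IsBounded Ω) {F : E n → E n} (hF : ContDiffOn ℝ 1 F Ω)
    {η : E n → ℝ} (hη : ContDiff ℝ 1 η) (h : tsupport η ⊆ Ω) :
    fluxPairing Ω F η = 0 := by
  have hcs : HasCompactSupport η :=
    hΩ.isCompact_closure.of_isClosed_subset (isClosed_tsupport η) (h.trans subset_closure)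
  have hFd : ∀ x ∈ Ω, DifferentiableAt ℝ F x := fun x hx =>
    (hF.contDiffAt (hΩo.mem_nhds hx)).differentiableAt one_ne_zero
  have hcoord : ∀ x ∈ Ω, ∀ j v, fderiv ℝ (fun y => F y j) x v = (fderiv ℝ F x v) j := by
    intro x hx j v
    have := ((EuclideanSpace.proj (𝕜 := ℝ) j).hasFDerivAt.comp x (hFd x hx).hasFDerivAt).fderiv
    have h2 : (fun y => F y j) = (EuclideanSpace.proj (𝕜 := ℝ) j) ∘ F := rfl
    rw [h2, this]; rfl
  have hFj : ∀ j, ContinuousOn (fun x => F x j) Ω := fun j =>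
    (EuclideanSpace.proj (𝕜 := ℝ) j).continuous.comp_continuousOn hF.continuousOn
  have hDj : ∀ j, Continuous
      (fun x => η x * fderiv ℝ (fun y => F y j) x (EuclideanSpace.single j 1)) := fun j => by
    refine continuous_mul_of_tsupport_subset hΩo hη.continuous ?_ h
    refine ((EuclideanSpace.proj (𝕜 := ℝ) j).continuous.comp_continuousOn
      (continuousOn_fderiv_apply hΩo hF (EuclideanSpace.single j 1))).congr ?_
    intro x hx
    exact hcoord x hx j _
  have hGj : ∀ j, Continuous
      (fun x => fderiv ℝ η x (EuclideanSpace.single j 1) * F x j) := fun j =>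
    continuous_mul_of_tsupport_subset hΩo
      ((hη.continuous_fderiv one_ne_zero).clm_apply continuous_const) (hFj j)
      ((tsupport_fderiv_apply_subset ℝ _).trans h)
  have hcsD : ∀ j, Integrable
      (fun x => η x * fderiv ℝ (fun y => F y j) x (EuclideanSpace.single j 1)) := fun j =>
    (hDj j).integrable_of_hasCompactSupport hcs.mul_right
  have hcsG : ∀ j, Integrable
      (fun x => fderiv ℝ η x (EuclideanSpace.single j 1) * F x j) := fun j =>
    (hGj j).integrable_of_hasCompactSupport (hcs.fderiv_apply (𝕜 := ℝ) _).mul_right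
  have key : ∀ j, ∫ x, (η x * fderiv ℝ (fun y => F y j) x (EuclideanSpace.single j 1)
      + fderiv ℝ η x (EuclideanSpace.single j 1) * F x j) = 0 := by
    intro j
    rw [integral_add (hcsD j) (hcsG j), integral_mul_fderiv_eq_neg_fderiv_mul_of_integrable
      (hcsG j) (hcsD j), neg_add_cancel]
    · exact (continuous_mul_of_tsupport_subset hΩo hη.continuous (hFj j)
        h).integrable_of_hasCompactSupport hcs.mul_right
    · exact fun x _ => hη.differentiable one_ne_zero x
    · exact fun x hx => (EuclideanSpace.proj (𝕜 := ℝ) j).differentiableAt.comp x (hFd x (h hx))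
  have hsum : ∀ x, η x * divergence F x + fderiv ℝ η x (F x) =
      ∑ j, (η x * fderiv ℝ (fun y => F y j) x (EuclideanSpace.single j 1)
      + fderiv ℝ η x (EuclideanSpace.single j 1) * F x j) := by
    intro x
    by_cases hx : x ∈ tsupport η
    · rw [Finset.sum_add_distrib, ← Finset.mul_sum]
      congr 1
      · simp only [hcoord x (h hx), divergence]
      · conv_lhs => rw [← (EuclideanSpace.basisFun (Fin n) ℝ).sum_repr (F x)]
        simp [mul_comm]
    · rw [fderiv_of_notMem_tsupport ℝ hx, image_eq_zero_of_notMem_tsupport hx]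
      simp
  unfold fluxPairing
  rw [setIntegral_eq_integral_of_forall_compl_eq_zero]
  · simp_rw [hsum]
    exact (integral_finsetSum _ fun j _ => (hcsD j).add (hcsG j)).trans
      (Finset.sum_eq_zero fun j _ => key j)
  · intro x hx
    have : x ∉ tsupport η := fun h' => hx (h h')
    rw [fderiv_of_notMem_tsupport ℝ this, image_eq_zero_of_notMem_tsupport this]
    simp

/-- Partition of unity argument: a functional vanishing for test functions supported near any point
of `closure Ω \ S` vanishes for test functions supported away from `S`. -/
theorem fluxPairing_eq_zero_of_locally {Ω S : Set (E n)} (hΩo : IsOpen Ω)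
    (hΩ : Bornology.IsBounded Ω)
    {F : E n → E n} (hF : IntegrableOn F Ω) (hdiv : IntegrableOn (divergence F) Ω)
    (hloc : ∀ x ∈ closure Ω, x ∉ S → ∃ r > 0, ∀ η : E n → ℝ, ContDiff ℝ 1 η →
      tsupport η ⊆ Metric.closedBall x r → fluxPairing Ω F η = 0)
    {η : E n → ℝ} (hη : ContDiff ℝ 1 η) (hS : ∀ x ∈ S, x ∉ tsupport η) :
    fluxPairing Ω F η = 0 := by
  have hK : IsCompact (tsupport η ∩ closure Ω) :=
    hΩ.isCompact_closure.inter_left (isClosed_tsupport η)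
  choose! r hr hr' using hloc
  obtain ⟨t, ht, htc⟩ := hK.elim_nhds_subcover (fun x => Metric.ball x (r x / 2)) (fun x hx =>
    Metric.ball_mem_nhds _ (half_pos (hr x hx.2 fun h => hS x h hx.1)))
  have ht' : ∀ x ∈ t, x ∈ closure Ω ∧ x ∉ S := fun x hx =>
    ⟨(ht x hx).2, fun h => hS x h (ht x hx).1⟩
  -- The induction changes `η`, so only the cover of its support within `closure Ω` is kept.
  clear hS ht hK
  induction t using Finset.induction_on generalizing η with
  | empty =>
    refine fluxPairing_eq_zero_of_disjoint fun x hx hx' => ?_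
    simpa using htc ⟨hx', subset_closure hx⟩
  | insert a t ha ih =>
    have hat := ht' a (Finset.mem_insert_self a t)
    have hra := hr a hat.1 hat.2
    let b : ContDiffBump a := ⟨r a / 2, r a, half_pos hra, half_lt_self hra⟩
    have hb : ContDiff ℝ 1 b := b.contDiff
    have h1 : ContDiff ℝ 1 (fun x => η x * b x) := hη.mul hb
    have h2 : ContDiff ℝ 1 (fun x => η x * (1 - b x)) := hη.mul (contDiff_const.sub hb)
    -- The first summand is supported in the ball of `a`; the second vanishes near every point of
    -- the half-radius ball, so the remaining balls cover its support.
    have heq : η = fun x => η x * b x + η x * (1 - b x) := by ext x; ring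
    rw [heq, fluxPairing_add hΩo hΩ hF hdiv h1 h2,
      hr' a hat.1 hat.2 _ h1 (tsupport_mul_subset_right.trans b.tsupport_eq.subset), zero_add]
    refine ih h2 ?_ fun x hx => ht' x (Finset.mem_insert_of_mem hx)
    rintro x ⟨hx, hxΩ⟩
    have hx1 := htc ⟨tsupport_mul_subset_left hx, hxΩ⟩
    rw [Finset.set_biUnion_insert] at hx1
    refine hx1.resolve_left fun hxa => ?_
    have h3 := tsupport_mul_subset_right hx
    rw [notMem_tsupport_iff_eventuallyEq.2 ?_ |> iff_false_intro] at h3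
    · exact h3
    · filter_upwards [b.eventuallyEq_one_of_mem_ball hxa] with y hy
      simp [hy]

/-! ### Vanishing flux near regular boundary points. -/

theorem contDiff_mul_of_tsupport_subset {U : Set (E n)} (hU : IsOpen U) {η f : E n → ℝ}
    (hη : ContDiff ℝ 1 η) (hf : ContDiffOn ℝ 1 f U) (h : tsupport η ⊆ U) :
    ContDiff ℝ 1 (fun x => η x * f x) := by
  refine contDiff_iff_contDiffAt.2 fun x => ?_
  by_cases hx : x ∈ tsupport η
  · exact hη.contDiffAt.mul (hf.contDiffAt (hU.mem_nhds (h hx)))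
  · refine (contDiffAt_const (c := (0 : ℝ))).congr_of_eventuallyEq ?_
    filter_upwards [notMem_tsupport_iff_eventuallyEq.1 hx] with y hy
    simp [hy]

/-- The cut-off function equal to `1` on `(-∞, -2]` and to `0` on `[-1, ∞)`. -/
noncomputable def innerCutoff (t : ℝ) : ℝ := Real.smoothTransition (-1 - t)

theorem contDiff_innerCutoff : ContDiff ℝ 1 innerCutoff :=
  (Real.smoothTransition.contDiff (n := 1)).comp (contDiff_const.sub contDiff_id)

theorem innerCutoff_nonneg (t : ℝ) : 0 ≤ innerCutoff t := Real.smoothTransition.nonneg _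

theorem innerCutoff_le_one (t : ℝ) : innerCutoff t ≤ 1 := Real.smoothTransition.le_one _

theorem innerCutoff_eq_one {t : ℝ} (ht : t ≤ -2) : innerCutoff t = 1 :=
  Real.smoothTransition.one_of_one_le (by linarith)

theorem innerCutoff_eq_zero {t : ℝ} (ht : -1 ≤ t) : innerCutoff t = 0 :=
  Real.smoothTransition.zero_of_nonpos (by linarith)

theorem deriv_innerCutoff_nonpos (t : ℝ) : deriv innerCutoff t ≤ 0 := by
  have : Antitone innerCutoff := fun a b hab => Real.smoothTransition.monotone (by linarith)
  exact this.deriv_nonpos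

theorem deriv_innerCutoff_eq_zero {t : ℝ} (ht : t < -2) : deriv innerCutoff t = 0 := by
  have : innerCutoff =ᶠ[𝓝 t] fun _ => (1 : ℝ) := by
    filter_upwards [Iio_mem_nhds ht] with s hs using innerCutoff_eq_one (le_of_lt hs)
  rw [this.deriv_eq, deriv_const]

theorem integral_fderiv_apply_eq_zero {f : E n → ℝ} (hf : ContDiff ℝ 1 f)
    (hc : HasCompactSupport f) (e : E n) : ∫ x, fderiv ℝ f x e = 0 := by
  have h := integral_mul_fderiv_eq_neg_fderiv_mul_of_integrable (μ := (volume : Measure (E n)))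
    (f := fun _ => (1 : ℝ)) (g := f) (v := e) (by simp)
    (by simpa using ((hf.continuous_fderiv one_ne_zero).clm_apply
      continuous_const).integrable_of_hasCompactSupport (hc.fderiv_apply (𝕜 := ℝ) e))
    (by simpa using hf.continuous.integrable_of_hasCompactSupport hc)
    (fun x _ => differentiableAt_const _) (fun x _ => hf.differentiable one_ne_zero x)
  simpa using h

/-- A boundary point has a neighbourhood in which the domain is a sublevel set of a function
strictly increasing in a fixed direction. -/
theorem exists_boundary_chart {Ω : Set (E n)} {x : E n} (hx : x ∈ regularBoundary Ω) :
    ∃ (U : Set (E n)) (ρ : E n → ℝ) (e : E n) (c R : ℝ), IsOpen U ∧ ContDiffOn ℝ 1 ρ U ∧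
      0 < c ∧ 0 < R ∧ Metric.closedBall x R ⊆ U ∧
      (∀ y ∈ U, y ∈ Ω ↔ ρ y < 0) ∧
      (∀ y ∈ Metric.closedBall x R, c ≤ fderiv ℝ ρ y e) ∧
      ∀ y ∈ Metric.closedBall x R, ρ y = 0 →
        IsOutwardUnitNormal Ω y (‖gradient ρ y‖⁻¹ • gradient ρ y) := by
  obtain ⟨ν, hxf, U, ρ, hU, hxU, hρ, hΩU, hg, -⟩ := hx
  have hmem : ∀ y ∈ U, y ∈ Ω ↔ ρ y < 0 := fun y hy => by
    have := congrArg (y ∈ ·) hΩU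
    simpa [hy] using this
  have hcont : ContinuousOn (fun y => fderiv ℝ ρ y (gradient ρ x)) U :=
    (hρ.continuousOn_fderiv_of_isOpen hU le_rfl).clm_apply continuousOn_const
  have hpos : 0 < fderiv ℝ ρ x (gradient ρ x) := by
    rw [← inner_gradient_left]
    exact real_inner_self_pos.2 hg
  have hev : ∀ᶠ y in 𝓝 x, y ∈ U ∧
      fderiv ℝ ρ x (gradient ρ x) / 2 < fderiv ℝ ρ y (gradient ρ x) :=
    (hU.eventually_mem hxU).and
      ((hcont.continuousAt (hU.mem_nhds hxU)).eventually (lt_mem_nhds (half_lt_self hpos)))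
  obtain ⟨R, hR, hball⟩ := Metric.nhds_basis_closedBall.eventually_iff.1 hev
  refine ⟨U, ρ, gradient ρ x, _, R, hU, hρ, half_pos hpos, hR, fun y hy => (hball hy).1, hmem,
    fun y hy => (hball hy).2.le, fun y hy hy0 => ?_⟩
  have hyU := (hball hy).1
  have hne : fderiv ℝ ρ y ≠ 0 := fun h0 => by
    have := (hball hy).2
    rw [h0] at this
    simp only [zero_apply] at this
    linarith
  have hyΩ : y ∉ Ω := fun h => by
    have := (hmem y hyU).1 h
    linarith
  refine ⟨⟨?_, fun h => hyΩ (interior_subset h)⟩, U, ρ, hU, hyU, hρ, hΩU, fun h0 => hne ?_, rfl⟩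
  -- A zero of `ρ` outside `closure Ω` would be a local minimum of `ρ`, contradicting the nonzero
  -- derivative.
  · by_contra hcl
    refine hne (IsLocalMin.fderiv_eq_zero ?_)
    filter_upwards [isClosed_closure.isOpen_compl.mem_nhds hcl, hU.mem_nhds hyU] with z hz hzU
    rw [hy0]
    by_contra hlt
    exact hz (subset_closure ((hmem z hzU).2 (not_le.1 hlt)))
  · ext v
    rw [← inner_gradient_left, h0]
    simp

/-- In a compact set, a continuous function that vanishes where `ρ = 0` is small where `ρ ≤ 0` is
close to `0`. -/
theorem exists_forall_abs_le_of_isCompact {K : Set (E n)} (hK : IsCompact K) {ρ f : E n → ℝ}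
    (hρ : ContinuousOn ρ K) (hf : ContinuousOn f K) (hρK : ∀ y ∈ K, ρ y ≤ 0)
    (h0 : ∀ y ∈ K, ρ y = 0 → f y = 0) {δ : ℝ} (hδ : 0 < δ) :
    ∃ ε > 0, ∀ y ∈ K, -ε ≤ ρ y → |f y| ≤ δ := by
  have hK' : IsCompact (K ∩ (fun y => |f y|) ⁻¹' Ici δ) :=
    hK.of_isClosed_subset (hf.abs.preimage_isClosed_of_isClosed hK.isClosed isClosed_Ici)
      inter_subset_left
  rcases (K ∩ (fun y => |f y|) ⁻¹' Ici δ).eq_empty_or_nonempty with he | hne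
  · refine ⟨1, one_pos, fun y hy _ => ?_⟩
    by_contra hlt
    have : y ∈ K ∩ (fun y => |f y|) ⁻¹' Ici δ := ⟨hy, (not_le.1 hlt).le⟩
    simp [he] at this
  · obtain ⟨z, hz, hmax⟩ := hK'.exists_isMaxOn hne (hρ.mono inter_subset_left)
    have hzneg : ρ z < 0 := lt_of_le_of_ne (hρK z hz.1) fun h => by
      have h1 : δ ≤ |f z| := hz.2
      rw [h0 z hz.1 h, abs_zero] at h1
      linarith
    -- `z` maximises `ρ` where `|f| ≥ δ`, so `|f| < δ` as soon as `ρ` exceeds `ρ z < 0`.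
    refine ⟨-ρ z / 2, by linarith, fun y hy hyρ => ?_⟩
    by_contra hlt
    have h2 : ρ y ≤ ρ z := hmax (show y ∈ K ∩ (fun y => |f y|) ⁻¹' Ici δ from
      ⟨hy, (not_le.1 hlt).le⟩)
    linarith

/-- Multiplying `η` by cut-offs that vanish near the boundary gives interior test functions; the
error is an integral over a thin strip of `q` times `dρ (u)` times a weight of size `k`. Tangency
and continuity of `u` make `dρ (u)` uniformly small there, while the weight has bounded total mass.
No surface measure or flattening of the boundary is involved. -/
theorem exists_ball_fluxPairing_eq_zero {Ω : Set (E n)} (hΩo : IsOpen Ω)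
    (hΩ : Bornology.IsBounded Ω) {u : E n → E n} {q : E n → ℝ} {M : ℝ}
    (hF : ContDiffOn ℝ 1 (fun x => q x • u x) Ω)
    (hFi : IntegrableOn (fun x => q x • u x) Ω)
    (hdiv : IntegrableOn (divergence (fun x => q x • u x)) Ω)
    (hu : ContinuousOn u (Ω ∪ regularBoundary Ω))
    (hun : ∀ x ν, IsOutwardUnitNormal Ω x ν → ⟪u x, ν⟫ = 0) (hq : ∀ x ∈ Ω, |q x| ≤ M)
    {x : E n} (hx : x ∈ regularBoundary Ω) :
    ∃ r > 0, ∀ η : E n → ℝ, ContDiff ℝ 1 η →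
      tsupport η ⊆ Metric.closedBall x r → fluxPairing Ω (fun x => q x • u x) η = 0 := by
  obtain ⟨U, ρ, e, c, R, hU, hρ, hc, hR, hRU, hmem, hce, hnormal⟩ := exists_boundary_chart hx
  refine ⟨R / 4, by positivity, fun η hη hηs => ?_⟩
  set F : E n → E n := fun x => q x • u x with hFdef
  let ζ : ContDiffBump x := ⟨R / 2, R, half_pos hR, half_lt_self hR⟩
  have hζ : ContDiff ℝ 1 ζ := ζ.contDiff
  have hζs : tsupport ζ ⊆ U := ζ.tsupport_eq.subset.trans hRU
  have hζ1 : ∀ y ∈ tsupport η, ∀ᶠ z in 𝓝 y, ζ z = 1 := fun y hy =>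
    ζ.eventuallyEq_one_of_mem_ball (Metric.closedBall_subset_ball (show R / 4 < R / 2 by linarith)
      (hηs hy))
  have hηR : tsupport η ⊆ Metric.closedBall x R :=
    hηs.trans (Metric.closedBall_subset_closedBall (by linarith))
  have hηU := hηR.trans hRU
  -- `g k` is `0` where `ρ ≥ -1/(k+1)` and `1` where `ρ ≤ -2/(k+1)`, so its derivative lives in a
  -- strip strictly inside the domain.
  let g : ℕ → E n → ℝ := fun k y => innerCutoff ((k + 1) * ρ y)
  have hg : ∀ k, ContDiffOn ℝ 1 (g k) U := fun k =>
    contDiff_innerCutoff.comp_contDiffOn (contDiffOn_const.mul hρ)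
  have hdg : ∀ k, ∀ y ∈ U, ∀ v, fderiv ℝ (g k) y v =
      deriv innerCutoff ((k + 1) * ρ y) * ((k + 1) * fderiv ℝ ρ y v) := by
    intro k y hy v
    have h1 := ((hρ.contDiffAt (hU.mem_nhds hy)).differentiableAt one_ne_zero).hasFDerivAt
    have h2 := (contDiff_innerCutoff.differentiable one_ne_zero
      ((k + 1) * ρ y)).hasDerivAt.comp_hasFDerivAt y (h1.const_mul ((k : ℝ) + 1))
    have h3 : g k = innerCutoff ∘ fun y => ((k : ℝ) + 1) * ρ y := rfl
    rw [h3, h2.fderiv]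
    simp
  let G : ℕ → E n → ℝ := fun k y => ζ y * g k y
  have hG : ∀ k, ContDiff ℝ 1 (G k) := fun k => contDiff_mul_of_tsupport_subset hU hζ (hg k) hζs
  have hGc : ∀ k, HasCompactSupport (G k) := fun k => ζ.hasCompactSupport.mul_right
  have hdG : ∀ k, ∀ y ∈ U, ∀ v, fderiv ℝ (G k) y v =
      ζ y * fderiv ℝ (g k) y v + fderiv ℝ ζ y v * g k y := by
    intro k y hy v
    have := fderiv_fun_mul (hζ.differentiable one_ne_zero y)
      (((hg k).contDiffAt (hU.mem_nhds hy)).differentiableAt one_ne_zero)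
    rw [show fderiv ℝ (G k) y = _ from this]
    simp [mul_comm]
  have hdGη : ∀ k, ∀ y ∈ tsupport η, ∀ v, fderiv ℝ (G k) y v = fderiv ℝ (g k) y v := by
    intro k y hy v
    have : G k =ᶠ[𝓝 y] g k := by
      filter_upwards [hζ1 y hy] with z hz
      simp [G, hz]
    rw [this.fderiv_eq]
  -- the mass of the boundary strip
  let P : ℕ → E n → ℝ := fun k y => fderiv ℝ ζ y e * g k y - fderiv ℝ (G k) y e
  have hdζs : tsupport (fun y => fderiv ℝ ζ y e) ⊆ tsupport ζ := tsupport_fderiv_apply_subset ℝ e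
  have hdζc : Continuous (fun y => fderiv ℝ ζ y e) :=
    (hζ.continuous_fderiv one_ne_zero).clm_apply continuous_const
  have hdζi : Integrable (fun y => fderiv ℝ ζ y e) :=
    hdζc.integrable_of_hasCompactSupport (ζ.hasCompactSupport.fderiv_apply (𝕜 := ℝ) e)
  have hP1 : ∀ k, Integrable (fun y => fderiv ℝ ζ y e * g k y) := fun k =>
    (continuous_mul_of_tsupport_subset hU hdζc (hg k).continuousOn
      (hdζs.trans hζs)).integrable_of_hasCompactSupport
      (ζ.hasCompactSupport.fderiv_apply (𝕜 := ℝ) e).mul_right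
  have hP2 : ∀ k, Integrable (fun y => fderiv ℝ (G k) y e) := fun k =>
    (((hG k).continuous_fderiv one_ne_zero).clm_apply
      continuous_const).integrable_of_hasCompactSupport ((hGc k).fderiv_apply (𝕜 := ℝ) e)
  have hPi : ∀ k, Integrable (P k) := fun k => (hP1 k).sub (hP2 k)
  -- The mass is bounded uniformly in `k` because the derivative of the compactly supported `G k`
  -- along `e` integrates to zero.
  have hPint : ∀ k, ∫ y, P k y ≤ ∫ y, |fderiv ℝ ζ y e| := by
    intro k
    rw [integral_sub (hP1 k) (hP2 k), integral_fderiv_apply_eq_zero (hG k) (hGc k), sub_zero]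
    refine integral_mono (hP1 k) hdζi.abs fun y => (le_abs_self _).trans ?_
    change |fderiv ℝ ζ y e * g k y| ≤ _
    rw [abs_mul]
    refine mul_le_of_le_one_right (abs_nonneg _) ?_
    rw [abs_of_nonneg (innerCutoff_nonneg _)]
    exact innerCutoff_le_one _
  have hPeq : ∀ k, ∀ y ∈ U, P k y =
      ζ y * (-deriv innerCutoff ((k + 1) * ρ y) * ((k + 1) * fderiv ℝ ρ y e)) := by
    intro k y hy
    simp only [P]
    rw [hdG k y hy, hdg k y hy]
    ring
  have hPnn : ∀ k y, 0 ≤ P k y := by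
    intro k y
    by_cases hy : y ∈ tsupport ζ
    · rw [hPeq k y (hζs hy)]
      have := hce y (ζ.tsupport_eq.subset hy)
      refine mul_nonneg ζ.nonneg (mul_nonneg (neg_nonneg.2 (deriv_innerCutoff_nonpos _))
        (mul_nonneg (by positivity) (hc.le.trans this)))
    · have h1 : y ∉ tsupport (G k) := fun h => hy (tsupport_mul_subset_left h)
      simp [P, fderiv_of_notMem_tsupport ℝ hy, fderiv_of_notMem_tsupport ℝ h1]
  -- the product of the cut-offs is an interior test function
  have hηG : ∀ k, ContDiff ℝ 1 (fun y => η y * G k y) := fun k => hη.mul (hG k)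
  have hηGs : ∀ k, tsupport (fun y => η y * G k y) ⊆ Ω := by
    intro k y hy
    have hyη : y ∈ tsupport η := tsupport_mul_subset_left hy
    have hyU := hηU hyη
    refine (hmem y hyU).2 (lt_of_not_ge fun hge => ?_)
    have hev : ∀ᶠ z in 𝓝 y, -1 < ((k : ℝ) + 1) * ρ z := by
      have hcts : ContinuousAt (fun z => ((k : ℝ) + 1) * ρ z) y :=
        continuousAt_const.mul (hρ.continuousOn.continuousAt (hU.mem_nhds hyU))
      refine hcts.eventually (lt_mem_nhds ?_)
      have : 0 ≤ ((k : ℝ) + 1) * ρ y := by positivity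
      linarith
    refine (notMem_tsupport_iff_eventuallyEq.2 ?_) hy
    filter_upwards [hev] with z hz
    simp [G, g, innerCutoff_eq_zero hz.le]
  let I : E n → ℝ := fun y => η y * divergence F y + fderiv ℝ η y (F y)
  have hI : IntegrableOn I Ω := (integrableOn_mul_of_continuous hΩo hΩ hdiv hη.continuous).add
      (integrableOn_fderiv_apply hΩo hΩ hFi hη)
  -- This is the vanishing of the flux pairing with the interior test function `η * G k`, expanded
  -- by the product rule.
  have hsplit : ∀ k, ∫ y in Ω, G k y * I y = - ∫ y in Ω, η y * fderiv ℝ (G k) y (F y) := by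
    intro k
    have h0 := fluxPairing_eq_zero_of_tsupport_subset hΩo hΩ hF (hηG k) (hηGs k)
    have hi1 := integrableOn_mul_of_continuous hΩo hΩ hI (hG k).continuous
    have hi2 := integrableOn_mul_of_continuous hΩo hΩ
      (integrableOn_fderiv_apply hΩo hΩ hFi (hG k)) hη.continuous
    rw [eq_neg_iff_add_eq_zero, ← integral_add hi1 hi2, ← h0]
    unfold fluxPairing
    congr 1
    ext y
    rw [fderiv_fun_mul (hη.differentiable one_ne_zero y) ((hG k).differentiable one_ne_zero y)]
    simp [I]
    ring
  have hlim : Tendsto (fun k => ∫ y in Ω, G k y * I y) atTop (𝓝 (∫ y in Ω, I y)) := by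
    refine tendsto_integral_of_dominated_convergence (fun y => |I y|)
      (fun k => (integrableOn_mul_of_continuous hΩo hΩ hI
        (hG k).continuous).aestronglyMeasurable) hI.abs
      (fun k => .of_forall fun y => ?_)
      ((ae_restrict_iff' hΩo.measurableSet).2 (.of_forall fun y hy => ?_))
    · rw [Real.norm_eq_abs, abs_mul]
      refine mul_le_of_le_one_left (abs_nonneg _) ?_
      rw [abs_of_nonneg (mul_nonneg ζ.nonneg (innerCutoff_nonneg _))]
      exact mul_le_one₀ ζ.le_one (innerCutoff_nonneg _) (innerCutoff_le_one _)
    · by_cases hyη : y ∈ tsupport η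
      · refine tendsto_const_nhds.congr' ?_
        have hneg := (hmem y (hηU hyη)).1 hy
        have ht : Tendsto (fun k : ℕ => ((k : ℝ) + 1) * ρ y) atTop atBot :=
          (tendsto_natCast_atTop_atTop.atTop_add tendsto_const_nhds).atTop_mul_const_of_neg hneg
        filter_upwards [ht.eventually_le_atBot (-2)] with k hk
        simp [G, g, innerCutoff_eq_one hk, (hζ1 y hyη).self_of_nhds]
      · simp [I, fderiv_of_notMem_tsupport ℝ hyη, image_eq_zero_of_notMem_tsupport hyη]
  -- the boundary term tends to zero
  let K : Set (E n) := tsupport η ∩ ρ ⁻¹' Iic 0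
  have hKc : IsCompact K :=
    (isCompact_closedBall x (R / 4)).of_isClosed_subset
      ((hρ.continuousOn.mono hηU).preimage_isClosed_of_isClosed (isClosed_tsupport η) isClosed_Iic)
      (inter_subset_left.trans hηs)
  have hKU : K ⊆ U := inter_subset_left.trans hηU
  have hKΩ : K ⊆ Ω ∪ regularBoundary Ω := by
    rintro y ⟨hy, hy0⟩
    rcases lt_or_eq_of_le (show ρ y ≤ 0 from hy0) with h | h
    · exact Or.inl ((hmem y (hηU hy)).2 h)
    · exact Or.inr ⟨_, hnormal y (hηR hy) h⟩
  have hDc : ContinuousOn (fun y => fderiv ℝ ρ y (u y)) K :=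
    ((hρ.continuousOn_fderiv_of_isOpen hU le_rfl).mono hKU).clm_apply (hu.mono hKΩ)
  -- On the zero set of `ρ` the normal is a nonzero multiple of `gradient ρ`, so tangency of `u` is
  -- the vanishing of `dρ (u)`.
  have hD0 : ∀ y ∈ K, ρ y = 0 → fderiv ℝ ρ y (u y) = 0 := by
    intro y hy h0
    have h1 := hnormal y (hηR hy.1) h0
    have h2 := hun y _ h1
    rw [inner_smul_right, real_inner_comm, inner_gradient_left] at h2
    rcases mul_eq_zero.1 h2 with h | h
    · exfalso
      have h3 : gradient ρ y = 0 := by simpa using h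
      have h4 := hce y (hηR hy.1)
      rw [← inner_gradient_left, h3, inner_zero_left] at h4
      linarith
    · exact h
  obtain ⟨A, hA⟩ := hΩ.isCompact_closure.exists_bound_of_continuousOn hη.continuous.continuousOn
  have hlim0 : Tendsto (fun k => ∫ y in Ω, G k y * I y) atTop (𝓝 0) := by
    rw [Metric.tendsto_atTop]
    intro t ht
    set C := ∫ y, |fderiv ℝ ζ y e| with hC
    have hCnn : 0 ≤ C := integral_nonneg fun y => abs_nonneg _
    obtain ⟨δ, hδ, hδt⟩ : ∃ δ > 0, |A| * |M| * δ / c * C < t := by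
      refine ⟨t / (|A| * |M| / c * C + 1), by positivity, ?_⟩
      have : |A| * |M| * (t / (|A| * |M| / c * C + 1)) / c * C =
        t * ((|A| * |M| / c * C) / (|A| * |M| / c * C + 1)) := by ring
      rw [this]
      refine mul_lt_of_lt_one_right ht ((div_lt_one (by positivity)).2 (by linarith))
    obtain ⟨ε, hε, hεK⟩ := exists_forall_abs_le_of_isCompact hKc (hρ.continuousOn.mono hKU) hDc
      (fun y hy => hy.2) hD0 hδ
    obtain ⟨N, hN⟩ := exists_nat_gt (2 / ε)
    refine ⟨N, fun k hk => ?_⟩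
    have hk' : 2 ≤ ((k : ℝ) + 1) * ε := by
      have h1 : (N : ℝ) ≤ k := by exact_mod_cast hk
      have h2 := (div_lt_iff₀ hε).1 hN
      nlinarith
    rw [hsplit, dist_zero_right, norm_neg]
    -- In the strip `|dρ (u)| ≤ δ ≤ (δ / c) * dρ (e)`, which trades the integrand for the density `P
    -- k` of controlled mass.
    have hbound : ∀ y ∈ Ω, ‖η y * fderiv ℝ (G k) y (F y)‖ ≤ |A| * |M| * δ / c * P k y := by
      intro y hy
      by_cases hyη : y ∈ tsupport η
      swap
      · rw [image_eq_zero_of_notMem_tsupport hyη, zero_mul, norm_zero]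
        have := hPnn k y
        positivity
      have hyU := hηU hyη
      have hyρ := (hmem y hyU).1 hy
      have hD := deriv_innerCutoff_nonpos ((k + 1) * ρ y)
      rw [hdGη k y hyη, hdg k y hyU, hPeq k y hyU, (hζ1 y hyη).self_of_nhds, one_mul]
      by_cases hlt : ((k : ℝ) + 1) * ρ y < -2
      · simp [deriv_innerCutoff_eq_zero hlt]
      have hyε : -ε ≤ ρ y := by
        by_contra hcon
        have h1 : ((k : ℝ) + 1) * (ρ y + ε) < 0 := mul_neg_of_pos_of_neg (by positivity)
          (by linarith)
        linarith
      have h1 := hεK y ⟨hyη, hyρ.le⟩ hyε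
      have h2 := hce y (hηR hyη)
      have h3 : |η y| ≤ |A| := (hA y (subset_closure hy)).trans (le_abs_self _)
      have h4 : |q y| ≤ |M| := (hq y hy).trans (le_abs_self _)
      have hFy : fderiv ℝ ρ y (F y) = q y * fderiv ℝ ρ y (u y) := by simp [hFdef]
      rw [hFy, Real.norm_eq_abs, abs_mul, abs_mul, abs_mul, abs_mul, abs_of_nonpos hD,
        abs_of_nonneg (show (0 : ℝ) ≤ k + 1 by positivity)]
      set d := -deriv innerCutoff ((k + 1) * ρ y) with hd
      have hd0 : 0 ≤ d := neg_nonneg.2 hD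
      calc |η y| * (d * ((k + 1) * (|q y| * |fderiv ℝ ρ y (u y)|)))
          ≤ |A| * (d * ((k + 1) * (|M| * δ))) := by gcongr
        _ = |A| * |M| * δ / c * (d * ((k + 1) * c)) := by field_simp
        _ ≤ |A| * |M| * δ / c * (d * ((k + 1) * fderiv ℝ ρ y e)) := by gcongr
    calc ‖∫ y in Ω, η y * fderiv ℝ (G k) y (F y)‖
        ≤ ∫ y in Ω, |A| * |M| * δ / c * P k y :=
          norm_integral_le_of_norm_le ((hPi k).integrableOn.const_mul _)
            ((ae_restrict_iff' hΩo.measurableSet).2 (.of_forall hbound))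
      _ ≤ ∫ y, |A| * |M| * δ / c * P k y :=
          setIntegral_le_integral ((hPi k).const_mul _) (.of_forall fun y =>
            mul_nonneg (by positivity) (hPnn k y))
      _ = |A| * |M| * δ / c * ∫ y, P k y := integral_const_mul _ _
      _ ≤ |A| * |M| * δ / c * C := mul_le_mul_of_nonneg_left (hPint k) (by positivity)
      _ < t := hδt
  exact tendsto_nhds_unique hlim hlim0

/-! ### Removing edges and corners by cut-offs of bounded Dirichlet energy. -/

/-- A compact set of finite `d`-dimensional Hausdorff measure is covered by finitely many small
balls for which the sum of the `d`-th powers of the radii is controlled. -/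
theorem exists_finite_ball_cover {X : Type*} [MetricSpace X] [MeasurableSpace X] [BorelSpace X]
    {S : Set X} (hS : IsCompact S) {d : ℝ} (h : Measure.hausdorffMeasure d S ≠ ⊤)
    {δ : ℝ} (hδ : 0 < δ) :
    ∃ (ι : Type) (t : Finset ι) (a : ι → X) (r : ι → ℝ), (∀ i, 0 < r i ∧ r i ≤ δ) ∧
      S ⊆ ⋃ i ∈ t, Metric.ball (a i) (r i) ∧
      ∑ i ∈ t, ENNReal.ofReal (r i ^ d) ≤ Measure.hausdorffMeasure d S + 2 := by
  set H : ℝ≥0∞ := Measure.hausdorffMeasure d S with hH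
  have hlt : H < H + 1 := ENNReal.lt_add_right h one_ne_zero
  have h1 := Measure.hausdorffMeasure_apply d S
  have h2 := le_iSup₂ (f := fun (r : ℝ≥0∞) (_ : 0 < r) =>
        ⨅ (t : ℕ → Set X) (_ : S ⊆ ⋃ n, t n) (_ : ∀ n, Metric.ediam (t n) ≤ r),
          ∑' n, ⨆ _ : (t n).Nonempty, Metric.ediam (t n) ^ d) (ENNReal.ofReal (δ / 2))
          (ENNReal.ofReal_pos.2 (half_pos hδ))
  rw [← h1, ← hH] at h2
  have h3 := h2.trans_lt hlt
  simp only [iInf_lt_iff] at h3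
  obtain ⟨t, htS, htd, hsum⟩ := h3
  obtain ⟨ε, hε, hεsum⟩ := ENNReal.exists_pos_sum_of_countable (ε := 1) one_ne_zero ℕ
  -- Needed since `d` may be negative, when a piece of zero diameter would contribute `⊤`.
  have hfin : ∀ j, (t j).Nonempty → Metric.ediam (t j) ^ d ≠ ⊤ := fun j hj => by
    refine ne_top_of_le_ne_top (hsum.trans_le le_top).ne ?_
    refine le_trans ?_ (ENNReal.le_tsum j)
    exact le_iSup (fun _ : (t j).Nonempty => Metric.ediam (t j) ^ d) hj
  have hex : ∀ j : {j // (t j).Nonempty}, ∃ (a : X) (r : ℝ), (0 < r ∧ r ≤ δ) ∧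
      t j ⊆ Metric.ball a r ∧ ENNReal.ofReal (r ^ d) ≤ Metric.ediam (t j) ^ d + ε j := by
    rintro ⟨j, a, ha⟩
    have hsδ : Metric.ediam (t j) < ENNReal.ofReal δ :=
      (htd j).trans_lt ((ENNReal.ofReal_lt_ofReal_iff hδ).2 (half_lt_self hδ))
    -- The radius is taken slightly above the diameter, so that the ball is open and contains the
    -- piece; continuity of the power bounds the loss by `ε j`, for either sign of `d`.
    have hev : ∀ᶠ y in 𝓝 (Metric.ediam (t j)), y ^ d < Metric.ediam (t j) ^ d + ε j ∧
        y < ENNReal.ofReal δ :=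
      (ENNReal.continuous_rpow_const.continuousAt.eventually (gt_mem_nhds
        (ENNReal.lt_add_right (hfin j ⟨a, ha⟩) (by exact_mod_cast (hε j).ne')))).and
        (gt_mem_nhds hsδ)
    have : (𝓝[>] (Metric.ediam (t j))).NeBot := nhdsGT_neBot_of_exists_gt ⟨_, hsδ⟩
    obtain ⟨y, ⟨hy1, hy2⟩, hy3⟩ :=
      ((hev.filter_mono (nhdsWithin_le_nhds (s := Ioi (Metric.ediam (t j))))).and
        self_mem_nhdsWithin).exists
    have hytop : y ≠ ⊤ := (hy2.trans_le le_top).ne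
    have hy0 : 0 < y.toReal := ENNReal.toReal_pos (bot_le.trans_lt hy3).ne' hytop
    refine ⟨a, y.toReal, ⟨hy0, ?_⟩, fun z hz => ?_, ?_⟩
    · exact ENNReal.toReal_le_of_le_ofReal hδ.le hy2.le
    · rw [Metric.mem_ball, dist_edist]
      exact ENNReal.toReal_strict_mono hytop ((Metric.edist_le_ediam_of_mem hz ha).trans_lt hy3)
    · rw [← ENNReal.ofReal_rpow_of_pos hy0, ENNReal.ofReal_toReal hytop]
      exact hy1.le
  choose a r hr htr hrd using hex
  obtain ⟨T, hT⟩ := hS.elim_finite_subcover (fun i => Metric.ball (a i) (r i))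
    (fun i => Metric.isOpen_ball) (fun x hx => by
      obtain ⟨j, hj⟩ := mem_iUnion.1 (htS hx)
      exact mem_iUnion.2 ⟨⟨j, x, hj⟩, htr ⟨j, x, hj⟩ hj⟩)
  refine ⟨{j // (t j).Nonempty}, T, a, r, hr, hT, ?_⟩
  calc ∑ i ∈ T, ENNReal.ofReal (r i ^ d)
      ≤ ∑ i ∈ T, ((⨆ _ : (t i).Nonempty, Metric.ediam (t i) ^ d) + ε i) := by
        refine Finset.sum_le_sum fun i _ => (hrd i).trans ?_
        gcongr
        exact le_iSup (fun _ : (t i).Nonempty => Metric.ediam (t i) ^ d) i.2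
    _ ≤ ∑' i : {j // (t j).Nonempty},
          ((⨆ _ : (t i).Nonempty, Metric.ediam (t i) ^ d) + (ε i : ℝ≥0∞)) := ENNReal.sum_le_tsum T
    _ ≤ ∑' j : ℕ, ((⨆ _ : (t j).Nonempty, Metric.ediam (t j) ^ d) + (ε j : ℝ≥0∞)) :=
        ENNReal.tsum_comp_le_tsum_of_injective Subtype.val_injective
          (fun j => (⨆ _ : (t j).Nonempty, Metric.ediam (t j) ^ d) + (ε j : ℝ≥0∞))
    _ = (∑' j : ℕ, ⨆ _ : (t j).Nonempty, Metric.ediam (t j) ^ d) + ∑' j, (ε j : ℝ≥0∞) :=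
        ENNReal.tsum_add
    _ ≤ (H + 1) + 1 := add_le_add hsum.le hεsum.le
    _ = H + 2 := by rw [add_assoc, one_add_one_eq_two]

/-- Bumps equal to `1` on `ball a r` and supported in `closedBall a (2 r)`, with gradient `O(1/r)`
uniformly in `a` and `r`. -/
theorem exists_scaled_bump (n : ℕ) : ∃ B : ℝ, 0 ≤ B ∧ ∀ (a : E n) (r : ℝ), 0 < r →
    ∃ ζ : E n → ℝ, ContDiff ℝ 1 ζ ∧ (∀ x ∈ Metric.ball a r, ζ x = 1) ∧
      (∀ x ∉ Metric.closedBall a (2 * r), ζ x = 0) ∧ (∀ x, ‖fderiv ℝ ζ x‖ ≤ B / r) := by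
  let b : ContDiffBump (0 : E n) := ⟨1, 2, one_pos, one_lt_two⟩
  have hb : ContDiff ℝ 1 b := b.contDiff
  obtain ⟨B, hB⟩ := (b.hasCompactSupport.fderiv (𝕜 := ℝ)).exists_bound_of_continuous
    (hb.continuous_fderiv one_ne_zero)
  refine ⟨B, (norm_nonneg _).trans (hB 0), fun a r hr => ?_⟩
  refine ⟨fun x => b (r⁻¹ • (x - a)), hb.comp ((contDiff_id.sub contDiff_const).const_smul _),
    fun x hx => ?_, fun x hx => ?_, fun x => ?_⟩
  · refine b.one_of_mem_closedBall ?_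
    rw [mem_closedBall_zero_iff, norm_smul, norm_inv, Real.norm_of_nonneg hr.le, ← dist_eq_norm]
    exact (inv_mul_le_one₀ hr).2 (Metric.mem_ball.1 hx).le
  · refine b.zero_of_le_dist ?_
    rw [dist_zero_right, norm_smul, norm_inv, Real.norm_of_nonneg hr.le, ← dist_eq_norm]
    have : 2 * r < dist x a := by simpa using hx
    exact (le_inv_mul_iff₀ hr).2 (by change r * 2 ≤ _; linarith)
  · have h1 : HasFDerivAt (fun x : E n => r⁻¹ • (x - a)) (r⁻¹ • ContinuousLinearMap.id ℝ (E n)) x :=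
      ((hasFDerivAt_id x).sub_const a).const_smul r⁻¹
    have h2 := (hb.differentiable one_ne_zero (r⁻¹ • (x - a))).hasFDerivAt.comp x h1
    have h3 : (fun x => b (r⁻¹ • (x - a))) = b ∘ fun x => r⁻¹ • (x - a) := rfl
    rw [h3, h2.fderiv, ContinuousLinearMap.comp_smul, ContinuousLinearMap.comp_id, norm_smul,
      norm_inv, Real.norm_of_nonneg hr.le, inv_mul_eq_div]
    exact div_le_div_of_nonneg_right (hB _) hr.le

theorem exists_bound_deriv_smoothTransition : ∃ D : ℝ, 0 ≤ D ∧ ∀ s : ℝ,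
    |deriv (fun s => Real.smoothTransition (1 - s)) s| ≤ D ∧
    (1 < s → deriv (fun s => Real.smoothTransition (1 - s)) s = 0) := by
  have hθ : ContDiff ℝ 1 (fun s => Real.smoothTransition (1 - s)) :=
    (Real.smoothTransition.contDiff (n := 1)).comp (contDiff_const.sub contDiff_id)
  have h1 : ∀ s, 1 < s → deriv (fun s => Real.smoothTransition (1 - s)) s = 0 := by
    intro s hs
    have : (fun s => Real.smoothTransition (1 - s)) =ᶠ[𝓝 s] fun _ => (0 : ℝ) := by
      filter_upwards [Ioi_mem_nhds hs] with z hz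
      exact Real.smoothTransition.zero_of_nonpos (by linarith [mem_Ioi.1 hz])
    rw [this.deriv_eq, deriv_const]
  have h0 : ∀ s, s < 0 → deriv (fun s => Real.smoothTransition (1 - s)) s = 0 := by
    intro s hs
    have : (fun s => Real.smoothTransition (1 - s)) =ᶠ[𝓝 s] fun _ => (1 : ℝ) := by
      filter_upwards [Iio_mem_nhds hs] with z hz
      exact Real.smoothTransition.one_of_one_le (by linarith [mem_Iio.1 hz])
    rw [this.deriv_eq, deriv_const]
  obtain ⟨D, hD⟩ := isCompact_Icc.exists_bound_of_continuousOn (s := Icc (0 : ℝ) 1)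
    (hθ.continuous_deriv le_rfl).continuousOn
  have hD0 : 0 ≤ D := (norm_nonneg _).trans (hD 0 (by simp))
  refine ⟨D, hD0, fun s => ⟨?_, h1 s⟩⟩
  rcases lt_or_ge s 0 with hs | hs
  · rwa [h0 s hs, abs_zero]
  rcases lt_or_ge 1 s with hs' | hs'
  · rwa [h1 s hs', abs_zero]
  exact hD s ⟨hs, hs'⟩

/-- With `s = ∑ ζ i ^ 2`, Cauchy–Schwarz gives `|ds|² ≤ 4 s ∑ |dζ i|²`, and the outer derivative
vanishes once `s > 1`. Composing with a sum of squares thus gives a bound independent of how many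
bumps overlap. -/
theorem norm_sq_fderiv_smoothTransition_sum_le {D : ℝ}
    (hD : ∀ s : ℝ, |deriv (fun s => Real.smoothTransition (1 - s)) s| ≤ D ∧
      (1 < s → deriv (fun s => Real.smoothTransition (1 - s)) s = 0))
    {ι : Type*} (t : Finset ι) {ζ : ι → E n → ℝ}
    (hζ : ∀ i, ContDiff ℝ 1 (ζ i)) (x : E n) :
    ‖fderiv ℝ (fun x => Real.smoothTransition (1 - ∑ i ∈ t, ζ i x ^ 2)) x‖ ^ 2 ≤
      4 * D ^ 2 * ∑ i ∈ t, ‖fderiv ℝ (ζ i) x‖ ^ 2 := by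
  have hθ : ContDiff ℝ 1 (fun s => Real.smoothTransition (1 - s)) :=
    (Real.smoothTransition.contDiff (n := 1)).comp (contDiff_const.sub contDiff_id)
  have hs : HasFDerivAt (fun x => ∑ i ∈ t, ζ i x ^ 2)
      (∑ i ∈ t, (2 * ζ i x) • fderiv ℝ (ζ i) x) x := by
    refine HasFDerivAt.fun_sum fun i _ => ?_
    simpa using ((hζ i).differentiable one_ne_zero x).hasFDerivAt.pow 2
  have hd := (hθ.differentiable one_ne_zero
      (∑ i ∈ t, ζ i x ^ 2)).hasDerivAt.comp_hasFDerivAt x hs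
  have heq : (fun x => Real.smoothTransition (1 - ∑ i ∈ t, ζ i x ^ 2)) =
    (fun s => Real.smoothTransition (1 - s)) ∘ fun x => ∑ i ∈ t, ζ i x ^ 2 := rfl
  rw [heq, hd.fderiv, norm_smul, mul_pow]
  set s := ∑ i ∈ t, ζ i x ^ 2 with hsdef
  set N := ∑ i ∈ t, ‖fderiv ℝ (ζ i) x‖ ^ 2
  have hN : 0 ≤ N := Finset.sum_nonneg fun i _ => sq_nonneg _
  rcases lt_or_ge 1 s with h1 | h1
  · rw [(hD s).2 h1]
    rw [norm_zero, zero_pow two_ne_zero, zero_mul]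
    positivity
  have hCS : ‖∑ i ∈ t, (2 * ζ i x) • fderiv ℝ (ζ i) x‖ ^ 2 ≤ 4 * N := by
    calc ‖∑ i ∈ t, (2 * ζ i x) • fderiv ℝ (ζ i) x‖ ^ 2
        ≤ (∑ i ∈ t, (2 * |ζ i x|) * ‖fderiv ℝ (ζ i) x‖) ^ 2 := by
          gcongr
          refine (norm_sum_le _ _).trans (Finset.sum_le_sum fun i _ => ?_)
          rw [norm_smul]
          simp
      _ ≤ (∑ i ∈ t, (2 * |ζ i x|) ^ 2) * N := Finset.sum_mul_sq_le_sq_mul_sq _ _ _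
      _ = 4 * s * N := by
          congr 1
          rw [hsdef, Finset.mul_sum]
          refine Finset.sum_congr rfl fun i _ => ?_
          rw [mul_pow, sq_abs]
          norm_num
      _ ≤ 4 * N := by nlinarith
  have hD2 : ‖deriv (fun s => Real.smoothTransition (1 - s)) s‖ ^ 2 ≤ D ^ 2 :=
    pow_le_pow_left₀ (norm_nonneg _) (hD s).1 2
  calc _ ≤ D ^ 2 * (4 * N) := mul_le_mul hD2 hCS (sq_nonneg _) (sq_nonneg _)
    _ = 4 * D ^ 2 * N := by ring

/-- A compact set of finite `(n - 2)`-dimensional Hausdorff measure can be cut out with bounded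
Dirichlet energy. -/
theorem exists_cutoff {S : Set (E n)} (hS : IsCompact S)
    (h : Measure.hausdorffMeasure ((n : ℝ) - 2) S ≠ ⊤) :
    ∃ C : ℝ, ∀ δ : ℝ≥0∞, 0 < δ → ∃ (η : E n → ℝ) (A : Set (E n)), ContDiff ℝ 1 η ∧
      (∀ x, 0 ≤ η x ∧ η x ≤ 1) ∧ (∀ x ∈ S, x ∉ tsupport η) ∧ MeasurableSet A ∧
      volume A < δ ∧ (∀ x ∉ A, η x = 1 ∧ fderiv ℝ η x = 0) ∧
      ∃ f : E n → ℝ, Integrable f ∧ (∀ x, ‖fderiv ℝ η x‖ ^ 2 ≤ f x) ∧ ∫ x, f x ≤ C := by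
  obtain ⟨B, hB0, hB⟩ := exists_scaled_bump n
  obtain ⟨D, hD0, hD⟩ := exists_bound_deriv_smoothTransition
  set H : ℝ≥0∞ := Measure.hausdorffMeasure ((n : ℝ) - 2) S with hH
  have hH2 : H + 2 ≠ ⊤ := ENNReal.add_ne_top.2 ⟨h, by simp⟩
  set ω : ℝ≥0∞ := volume (Metric.closedBall (0 : E n) 1) with hω
  have hωt : ω ≠ ⊤ := measure_closedBall_lt_top.ne
  have hvol : ∀ (a : E n) (r : ℝ), 0 < r →
      volume (Metric.closedBall a (2 * r)) = ENNReal.ofReal ((2 * r) ^ n) * ω := fun a r hr => by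
    have := Measure.addHaar_closedBall_mul_of_pos (volume : Measure (E n)) a
      (show (0 : ℝ) < 2 * r by positivity) 1
    rwa [mul_one, finrank_euclideanSpace_fin] at this
  -- This identity serves twice: the volume of a ball is `r ^ 2` times a summable quantity, hence
  -- small in total, while the energy `r ^ n * r ^ (-2)` is that quantity itself, hence only
  -- bounded.
  have hpow : ∀ r : ℝ, 0 < r → r ^ n = r ^ 2 * r ^ ((n : ℝ) - 2) := fun r hr => by
    rw [Real.rpow_sub hr, Real.rpow_natCast, Real.rpow_two]
    field_simp
  refine ⟨4 * D ^ 2 * (B ^ 2 * 2 ^ n * ω.toReal * (H + 2).toReal), fun δ hδ => ?_⟩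
  obtain ⟨δ₀, hδ₀, hδ₀'⟩ : ∃ δ₀ : ℝ, 0 < δ₀ ∧
      ENNReal.ofReal (2 ^ n * δ₀ ^ 2) * ω * (H + 2) < δ := by
    have hc : Tendsto (fun s : ℝ => ENNReal.ofReal (2 ^ n * s ^ 2) * ω * (H + 2)) (𝓝 0) (𝓝 0) := by
      have h1 : Tendsto (fun s : ℝ => ENNReal.ofReal (2 ^ n * s ^ 2)) (𝓝 0) (𝓝 0) := by
        have : Continuous (fun s : ℝ => ENNReal.ofReal (2 ^ n * s ^ 2)) :=
          ENNReal.continuous_ofReal.comp (by fun_prop)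
        simpa using this.tendsto 0
      have h2 := ENNReal.Tendsto.mul_const (b := H + 2)
        (ENNReal.Tendsto.mul_const (b := ω) h1 (Or.inr hωt)) (Or.inr hH2)
      simpa using h2
    have hev := (hc.eventually (gt_mem_nhds hδ)).filter_mono
      (nhdsWithin_le_nhds (s := Ioi (0 : ℝ)))
    obtain ⟨s, hs1, hs2⟩ := (hev.and self_mem_nhdsWithin).exists
    exact ⟨s, hs2, hs1⟩
  obtain ⟨ι, t, a, r, hr, hcov, hsum⟩ := exists_finite_ball_cover hS h hδ₀
  choose ζ hζ hζ1 hζ0 hζB using fun i => hB (a i) (r i) (hr i).1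
  set A : Set (E n) := ⋃ i ∈ t, Metric.closedBall (a i) (2 * r i) with hA
  have hAcl : IsClosed A := t.finite_toSet.isClosed_biUnion fun i _ => Metric.isClosed_closedBall
  let η : E n → ℝ := fun x => Real.smoothTransition (1 - ∑ i ∈ t, ζ i x ^ 2)
  have hη : ContDiff ℝ 1 η := (Real.smoothTransition.contDiff (n := 1)).comp
    (contDiff_const.sub (ContDiff.sum fun i _ => (hζ i).pow 2))
  have hη1 : ∀ x ∉ A, η x = 1 := fun x hx => by
    have : ∑ i ∈ t, ζ i x ^ 2 = 0 := Finset.sum_eq_zero fun i hi => by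
      rw [hζ0 i x fun hxi => hx (mem_biUnion hi hxi)]; simp
    simp [η, this]
  let f : E n → ℝ := fun x => 4 * D ^ 2 *
    ∑ i ∈ t, (Metric.closedBall (a i) (2 * r i)).indicator (fun _ => (B / r i) ^ 2) x
  have hfi : ∀ i, Integrable
      ((Metric.closedBall (a i) (2 * r i)).indicator (fun _ => (B / r i) ^ 2)) := fun i =>
    (integrable_indicator_iff Metric.isClosed_closedBall.measurableSet).2
      (integrableOn_const measure_closedBall_lt_top.ne)
  refine ⟨η, A, hη, fun x => ⟨Real.smoothTransition.nonneg _, Real.smoothTransition.le_one _⟩, ?_,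
    hAcl.measurableSet, ?_, fun x hx => ⟨hη1 x hx, ?_⟩, f,
    (integrable_finsetSum _ fun i _ => hfi i).const_mul _, fun x => ?_, ?_⟩
  · intro x hx
    obtain ⟨i, hi, hxi⟩ := mem_iUnion₂.1 (hcov hx)
    refine notMem_tsupport_iff_eventuallyEq.2 ?_
    filter_upwards [Metric.isOpen_ball.mem_nhds hxi] with y hy
    refine Real.smoothTransition.zero_of_nonpos ?_
    have := Finset.single_le_sum (f := fun i => ζ i y ^ 2) (fun i _ => sq_nonneg _) hi
    simp only [hζ1 i y hy] at this
    linarith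
  · refine lt_of_le_of_lt ?_ hδ₀'
    calc volume A ≤ ∑ i ∈ t, volume (Metric.closedBall (a i) (2 * r i)) :=
          measure_biUnion_finset_le _ _
      _ ≤ ∑ i ∈ t, ENNReal.ofReal (2 ^ n * δ₀ ^ 2) * ω *
            ENNReal.ofReal (r i ^ ((n : ℝ) - 2)) := by
          refine Finset.sum_le_sum fun i _ => ?_
          have hri := (hr i).1
          rw [hvol _ _ hri, mul_right_comm, ← ENNReal.ofReal_mul (by positivity)]
          gcongr
          rw [mul_pow, hpow _ hri, ← mul_assoc]
          have := (hr i).2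
          gcongr
      _ ≤ _ := by
          rw [← Finset.mul_sum]
          gcongr
  · have : η =ᶠ[𝓝 x] fun _ => (1 : ℝ) := by
      filter_upwards [hAcl.isOpen_compl.mem_nhds hx] with y hy using hη1 y hy
    rw [this.fderiv_eq, fderiv_const_apply]
  · refine (norm_sq_fderiv_smoothTransition_sum_le hD t hζ x).trans ?_
    refine mul_le_mul_of_nonneg_left (Finset.sum_le_sum fun i _ => ?_) (by positivity)
    by_cases hx : x ∈ Metric.closedBall (a i) (2 * r i)
    · rw [indicator_of_mem hx]
      exact pow_le_pow_left₀ (norm_nonneg _) (hζB i x) 2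
    · rw [indicator_of_notMem hx]
      have : ζ i =ᶠ[𝓝 x] fun _ => (0 : ℝ) := by
        filter_upwards [Metric.isClosed_closedBall.isOpen_compl.mem_nhds hx] with y hy
          using hζ0 i y hy
      rw [this.fderiv_eq, fderiv_const_apply]
      simp
  · simp only [f]
    rw [integral_const_mul, integral_finsetSum _ fun i _ => hfi i]
    refine mul_le_mul_of_nonneg_left ?_ (by positivity)
    have hterm : ∀ i, ∫ x, (Metric.closedBall (a i) (2 * r i)).indicator
        (fun _ => (B / r i) ^ 2) x = B ^ 2 * 2 ^ n * ω.toReal * r i ^ ((n : ℝ) - 2) := by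
      intro i
      have hri := (hr i).1
      rw [integral_indicator_const _ Metric.isClosed_closedBall.measurableSet, Measure.real,
        hvol _ _ hri, ENNReal.toReal_mul, ENNReal.toReal_ofReal (by positivity), smul_eq_mul,
        mul_pow, hpow _ hri]
      field_simp
    simp_rw [hterm]
    rw [← Finset.mul_sum]
    refine mul_le_mul_of_nonneg_left ?_ (by positivity)
    have := ENNReal.toReal_mono hH2 hsum
    rw [ENNReal.toReal_sum (fun _ _ => ENNReal.ofReal_ne_top)] at this
    refine le_trans (le_of_eq (Finset.sum_congr rfl fun i _ => ?_)) this
    rw [ENNReal.toReal_ofReal (Real.rpow_nonneg (hr i).1.le _)]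

/-- In a boundary chart every frontier point satisfies `ρ = 0` and is therefore regular, so the
regular part is relatively open in the frontier. -/
theorem isCompact_frontier_diff_regularBoundary {Ω : Set (E n)} (hΩo : IsOpen Ω)
    (hΩ : Bornology.IsBounded Ω) : IsCompact (frontier Ω \ regularBoundary Ω) := by
  refine hΩ.isCompact_closure.of_isClosed_subset ?_ (sdiff_subset.trans frontier_subset_closure)
  rw [← isOpen_compl_iff, isOpen_iff_mem_nhds]
  intro x hx
  by_cases hxf : x ∈ frontier Ω
  swap
  · filter_upwards [isClosed_frontier.isOpen_compl.mem_nhds hxf] with y hy h using hy h.1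
  have hxr : x ∈ regularBoundary Ω := by
    by_contra h
    exact hx ⟨hxf, h⟩
  obtain ⟨U, ρ, e, c, R, hU, hρ, -, hR, hRU, hmem, -, hnormal⟩ := exists_boundary_chart hxr
  filter_upwards [Metric.closedBall_mem_nhds x hR] with y hy
  rintro ⟨hyf, hyr⟩
  have hyU := hRU hy
  refine hyr ⟨_, hnormal y hy (le_antisymm (not_lt.1 fun hpos => ?_) (not_lt.1 fun hneg => ?_))⟩
  · have hev := (hU.eventually_mem hyU).and
      ((hρ.continuousOn.continuousAt (hU.mem_nhds hyU)).eventually (lt_mem_nhds hpos))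
    obtain ⟨z, ⟨hzU, hz⟩, hzΩ⟩ := mem_closure_iff_nhds.1 hyf.1 _ hev
    exact absurd ((hmem z hzU).1 hzΩ) (not_lt.2 hz.le)
  · have := (hmem y hyU).2 hneg
    rw [hΩo.frontier_eq] at hyf
    exact hyf.2 this

/-- If a functional vanishes on test functions supported away from a set of finite
`(n - 2)`-dimensional Hausdorff measure, it vanishes on constants. -/
theorem integral_divergence_eq_zero_of_fluxPairing {Ω S : Set (E n)} (hΩo : IsOpen Ω)
    (hΩ : Bornology.IsBounded Ω) (hS : IsCompact S)
    (hHS : Measure.hausdorffMeasure ((n : ℝ) - 2) S ≠ ⊤) {F : E n → E n}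
    (hF : MemLp F 2 (volume.restrict Ω)) (hFi : IntegrableOn F Ω)
    (hdiv : IntegrableOn (divergence F) Ω)
    (h : ∀ η : E n → ℝ, ContDiff ℝ 1 η → (∀ x ∈ S, x ∉ tsupport η) → fluxPairing Ω F η = 0) :
    ∫ x in Ω, divergence F x = 0 := by
  obtain ⟨C, hC⟩ := exists_cutoff hS hHS
  by_contra hne
  set ε := |∫ x in Ω, divergence F x| with hεdef
  have hε : 0 < ε := abs_pos.2 hne
  -- The weight in Young's inequality: the energy term costs at most `τ / 2 * C < ε / 2`. The term
  -- `τ⁻¹ * ‖F‖ ^ 2` is then made small by shrinking the volume of `A`, as `C` does not depend on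
  -- that volume.
  set τ := ε / (|C| + 1) with hτdef
  have hτ : 0 < τ := by positivity
  let g : E n → ℝ := fun x => ‖divergence F x‖ + τ⁻¹ * ‖F x‖ ^ 2
  have hg : IntegrableOn g Ω := hdiv.norm.add (hF.integrable_norm_pow two_ne_zero |>.const_mul _)
  obtain ⟨δ, hδ, hδA⟩ := exists_pos_setLIntegral_lt_of_measure_lt (μ := volume.restrict Ω)
    hg.2.ne (ENNReal.ofReal_pos.2 (half_pos hε)).ne'
  obtain ⟨η, A, hη, hη01, hηS, hAm, hAδ, hηA, f, hf, hηf, hfC⟩ := hC δ hδ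
  have hgA : ∫ x in Ω, A.indicator g x < ε / 2 := by
    rw [integral_indicator hAm]
    have h1 := hδA A ((Measure.restrict_apply_le _ _).trans_lt hAδ)
    have h2 := (enorm_integral_le_lintegral_enorm (μ := (volume.restrict Ω).restrict A) g).trans_lt
      h1
    rw [Real.enorm_eq_ofReal_abs, ENNReal.ofReal_lt_ofReal_iff (half_pos hε)] at h2
    exact (le_abs_self _).trans_lt h2
  have hf0 : ∀ x, 0 ≤ f x := fun x => (sq_nonneg _).trans (hηf x)
  have hfΩ : ∫ x in Ω, τ / 2 * f x < ε / 2 := by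
    calc ∫ x in Ω, τ / 2 * f x ≤ ∫ x, τ / 2 * f x :=
          setIntegral_le_integral (hf.const_mul _) (.of_forall fun x =>
            mul_nonneg (by positivity) (hf0 x))
      _ = τ / 2 * ∫ x, f x := integral_const_mul _ _
      _ ≤ τ / 2 * |C| := by gcongr; exact hfC.trans (le_abs_self _)
      _ = ε / 2 * (|C| / (|C| + 1)) := by rw [hτdef]; ring
      _ < ε / 2 := mul_lt_of_lt_one_right (half_pos hε)
          ((div_lt_one (by positivity)).2 (by linarith))
  have hrep : ∫ x in Ω, divergence F x =
      ∫ x in Ω, (divergence F x - (η x * divergence F x + fderiv ℝ η x (F x))) := by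
    have hi : IntegrableOn (fun x => η x * divergence F x + fderiv ℝ η x (F x)) Ω :=
      (integrableOn_mul_of_continuous hΩo hΩ hdiv hη.continuous).add
        (integrableOn_fderiv_apply hΩo hΩ hFi hη)
    have h0 : ∫ x in Ω, (η x * divergence F x + fderiv ℝ η x (F x)) = 0 := h η hη hηS
    rw [integral_sub hdiv hi, h0, sub_zero]
  have hbound : ∀ x, ‖divergence F x - (η x * divergence F x + fderiv ℝ η x (F x))‖ ≤
      A.indicator g x + τ / 2 * f x := by
    intro x
    by_cases hx : x ∈ A
    · rw [indicator_of_mem hx]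
      have h1 : ‖divergence F x - (η x * divergence F x + fderiv ℝ η x (F x))‖ ≤
          ‖divergence F x‖ + ‖fderiv ℝ η x‖ * ‖F x‖ := by
        have h2 : divergence F x - (η x * divergence F x + fderiv ℝ η x (F x)) =
          (1 - η x) * divergence F x - fderiv ℝ η x (F x) := by ring
        rw [h2]
        refine (norm_sub_le _ _).trans (add_le_add ?_ (ContinuousLinearMap.le_opNorm _ _))
        rw [norm_mul]
        refine mul_le_of_le_one_left (norm_nonneg _) ?_
        rw [Real.norm_eq_abs, abs_le]
        constructor <;> linarith [(hη01 x).1, (hη01 x).2]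
      have h3 : ‖fderiv ℝ η x‖ * ‖F x‖ ≤ τ⁻¹ * ‖F x‖ ^ 2 + τ / 2 * ‖fderiv ℝ η x‖ ^ 2 := by
        have h4 : 0 ≤ τ / 2 * (‖fderiv ℝ η x‖ - τ⁻¹ * ‖F x‖) ^ 2 := by positivity
        have h5 : τ / 2 * (‖fderiv ℝ η x‖ - τ⁻¹ * ‖F x‖) ^ 2 = τ / 2 * ‖fderiv ℝ η x‖ ^ 2
          - ‖fderiv ℝ η x‖ * ‖F x‖ + τ⁻¹ * ‖F x‖ ^ 2 / 2 := by
          field_simp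
          ring
        have h6 : 0 ≤ τ⁻¹ * ‖F x‖ ^ 2 := by positivity
        linarith
      have h7 : τ / 2 * ‖fderiv ℝ η x‖ ^ 2 ≤ τ / 2 * f x :=
        mul_le_mul_of_nonneg_left (hηf x) (by positivity)
      simp only [g]
      linarith
    · rw [indicator_of_notMem hx, (hηA x hx).1, (hηA x hx).2]
      have := hf0 x
      simp
      positivity
  have hfin : ε ≤ ∫ x in Ω, (A.indicator g x + τ / 2 * f x) := by
    rw [hεdef, hrep]
    exact norm_integral_le_of_norm_le ((hg.indicator hAm).add (hf.integrableOn.const_mul _))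
      (.of_forall hbound)
  rw [integral_add (hg.indicator hAm) (hf.integrableOn.const_mul _)] at hfin
  linarith

/-! ### The divergence theorem for tangential fields. -/

/-- A divergence theorem: the field `q u` with `q` bounded and `u` tangent to the regular part of
the boundary has no flux through the boundary. -/
theorem integral_divergence_smul_eq_zero {Ω : Set (E n)} (hΩo : IsOpen Ω)
    (hΩ : Bornology.IsBounded Ω) (hS : HasPiecewiseSmoothBoundary Ω)
    {u : E n → E n} {q : E n → ℝ} {M : ℝ}
    (hF : ContDiffOn ℝ 1 (fun x => q x • u x) Ω)
    (hF2 : MemLp (fun x => q x • u x) 2 (volume.restrict Ω))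
    (hdiv : IntegrableOn (divergence (fun x => q x • u x)) Ω)
    (hu : ContinuousOn u (Ω ∪ regularBoundary Ω))
    (hun : ∀ x ν, IsOutwardUnitNormal Ω x ν → ⟪u x, ν⟫ = 0) (hq : ∀ x ∈ Ω, |q x| ≤ M) :
    ∫ x in Ω, divergence (fun x => q x • u x) x = 0 := by
  have : IsFiniteMeasure (volume.restrict Ω) :=
    isFiniteMeasure_restrict.2 hΩ.measure_lt_top.ne
  have hFi : IntegrableOn (fun x => q x • u x) Ω := hF2.integrable one_le_two
  refine integral_divergence_eq_zero_of_fluxPairing hΩo hΩ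
    (isCompact_frontier_diff_regularBoundary hΩo hΩ) (ne_of_lt hS) hF2 hFi hdiv
    fun η hη hηS => fluxPairing_eq_zero_of_locally hΩo hΩ hFi hdiv (fun x hx hxS => ?_) hη hηS
  by_cases hxΩ : x ∈ Ω
  · obtain ⟨r, hr, hball⟩ := Metric.nhds_basis_closedBall.mem_iff.1 (hΩo.mem_nhds hxΩ)
    exact ⟨r, hr, fun θ hθ hθs =>
      fluxPairing_eq_zero_of_tsupport_subset hΩo hΩ hF hθ (hθs.trans hball)⟩
  · refine exists_ball_fluxPairing_eq_zero hΩo hΩ hF hFi hdiv hu hun hq ?_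
    by_contra h
    exact hxS ⟨hΩo.frontier_eq ▸ ⟨hx, hxΩ⟩, h⟩

theorem divergence_smul {q : E n → ℝ} {u : E n → E n} {x : E n} (hq : DifferentiableAt ℝ q x)
    (hu : DifferentiableAt ℝ u x) :
    divergence (fun x => q x • u x) x = q x * divergence u x + fderiv ℝ q x (u x) := by
  unfold divergence
  rw [fderiv_fun_smul hq hu, Finset.mul_sum]
  conv_rhs => rw [← (EuclideanSpace.basisFun (Fin n) ℝ).sum_repr (u x)]
  simp [Finset.sum_add_distrib, mul_comm]

theorem divergence_sub {u w : E n → E n} {x : E n} (hu : DifferentiableAt ℝ u x)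
    (hw : DifferentiableAt ℝ w x) :
    divergence (fun x => u x - w x) x = divergence u x - divergence w x := by
  unfold divergence
  rw [fderiv_fun_sub hu hw]
  simp [Finset.sum_sub_distrib]

/-! ### Truncated pressures and integration by parts. -/

/-- A bounded smooth `1`-Lipschitz function, close to the identity for small `ε`. -/
noncomputable def softTruncation (ε s : ℝ) : ℝ := s / (1 + (ε * s) ^ 2)

theorem hasDerivAt_softTruncation (ε s : ℝ) :
    HasDerivAt (softTruncation ε) ((1 - (ε * s) ^ 2) / (1 + (ε * s) ^ 2) ^ 2) s := by
  have h1 : HasDerivAt (fun s : ℝ => 1 + (ε * s) ^ 2) (2 * (ε * s) * ε) s := by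
    simpa using (((hasDerivAt_id s).const_mul ε).pow 2).const_add 1
  have h2 := (hasDerivAt_id s).div h1 (by positivity)
  have h3 : (1 * (1 + (ε * s) ^ 2) - id s * (2 * (ε * s) * ε)) / (1 + (ε * s) ^ 2) ^ 2 =
      (1 - (ε * s) ^ 2) / (1 + (ε * s) ^ 2) ^ 2 := by
    congr 1
    simp only [id]
    ring
  rw [← h3]
  exact h2

theorem contDiff_softTruncation (ε : ℝ) : ContDiff ℝ 1 (softTruncation ε) :=
  contDiff_id.div (contDiff_const.add ((contDiff_const.mul contDiff_id).pow 2)) fun s => by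
    positivity

theorem abs_softTruncation_le {ε : ℝ} (hε : 0 < ε) (s : ℝ) : |softTruncation ε s| ≤ ε⁻¹ := by
  rw [softTruncation, abs_div, abs_of_pos (show 0 < 1 + (ε * s) ^ 2 by positivity),
    div_le_iff₀ (by positivity), ← mul_le_mul_iff_right₀ hε, ← mul_assoc, mul_inv_cancel₀ hε.ne',
    one_mul, ← abs_of_pos hε, ← abs_mul, abs_of_pos hε, ← sq_abs (ε * s)]
  nlinarith [sq_nonneg (|ε * s| - 1), abs_nonneg (ε * s)]

/-- Only the pressure difference times the divergence is known to be integrable; the Lipschitz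
constant `1` lets it dominate the truncated difference. -/
theorem abs_softTruncation_sub_le (ε s t : ℝ) :
    |softTruncation ε s - softTruncation ε t| ≤ |s - t| := by
  have h : softTruncation ε s - softTruncation ε t =
      (s - t) * ((1 - ε * s * (ε * t)) / ((1 + (ε * s) ^ 2) * (1 + (ε * t) ^ 2))) := by
    unfold softTruncation
    field_simp
    ring
  rw [h, abs_mul]
  refine mul_le_of_le_one_right (abs_nonneg _) ?_
  rw [abs_div, abs_of_pos (show 0 < (1 + (ε * s) ^ 2) * (1 + (ε * t) ^ 2) by positivity),
    div_le_one (by positivity), abs_le]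
  constructor <;>
    nlinarith [sq_nonneg (ε * s + ε * t), sq_nonneg (ε * s - ε * t), sq_nonneg (ε * s * (ε * t)),
      sq_nonneg (ε * s), sq_nonneg (ε * t)]

theorem abs_deriv_softTruncation_le (ε s : ℝ) :
    |(1 - (ε * s) ^ 2) / (1 + (ε * s) ^ 2) ^ 2| ≤ 1 := by
  rw [abs_div, abs_of_pos (show 0 < (1 + (ε * s) ^ 2) ^ 2 by positivity),
    div_le_one (by positivity), abs_le]
  constructor <;> nlinarith [sq_nonneg (ε * s), sq_nonneg ((ε * s) ^ 2)]

theorem tendsto_softTruncation (s : ℝ) :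
    Tendsto (fun ε => softTruncation ε s) (𝓝 0) (𝓝 s) := by
  have : Continuous (fun ε => softTruncation ε s) := by
    unfold softTruncation
    exact continuous_const.div (by fun_prop) fun ε => by positivity
  simpa [softTruncation] using this.tendsto 0

theorem tendsto_deriv_softTruncation (s : ℝ) :
    Tendsto (fun ε : ℝ => (1 - (ε * s) ^ 2) / (1 + (ε * s) ^ 2) ^ 2) (𝓝 0) (𝓝 1) := by
  have : Continuous (fun ε : ℝ => (1 - (ε * s) ^ 2) / (1 + (ε * s) ^ 2) ^ 2) :=
    Continuous.div (by fun_prop) (by fun_prop) fun ε => by positivity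
  simpa using this.tendsto 0

/-- Truncating makes the multiplier bounded by `ε⁻¹`, so the product field is square integrable and
the divergence theorem applies with no boundary behaviour required of `q`. -/
theorem integral_softTruncation_eq_zero {Ω : Set (E n)} (hΩo : IsOpen Ω)
    (hΩ : Bornology.IsBounded Ω) (hS : HasPiecewiseSmoothBoundary Ω)
    {u : E n → E n} {q : E n → ℝ} (hu1 : ContDiffOn ℝ 1 u Ω) (hq1 : ContDiffOn ℝ 1 q Ω)
    (hu2 : MemLp u 2 (volume.restrict Ω)) (hdiv : IntegrableOn (divergence u) Ω)
    (hqu : IntegrableOn (fun x => fderiv ℝ q x (u x)) Ω)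
    (hu : ContinuousOn u (Ω ∪ regularBoundary Ω))
    (hun : ∀ x ν, IsOutwardUnitNormal Ω x ν → ⟪u x, ν⟫ = 0) {ε : ℝ} (hε : 0 < ε) :
    IntegrableOn (fun x => softTruncation ε (q x) * divergence u x +
      (1 - (ε * q x) ^ 2) / (1 + (ε * q x) ^ 2) ^ 2 * fderiv ℝ q x (u x)) Ω ∧
    ∫ x in Ω, (softTruncation ε (q x) * divergence u x +
      (1 - (ε * q x) ^ 2) / (1 + (ε * q x) ^ 2) ^ 2 * fderiv ℝ q x (u x)) = 0 := by
  have hT : ContDiffOn ℝ 1 (fun x => softTruncation ε (q x)) Ω :=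
    (contDiff_softTruncation ε).comp_contDiffOn hq1
  have hdivT : ∀ x ∈ Ω, divergence (fun x => softTruncation ε (q x) • u x) x =
      softTruncation ε (q x) * divergence u x +
      (1 - (ε * q x) ^ 2) / (1 + (ε * q x) ^ 2) ^ 2 * fderiv ℝ q x (u x) := by
    intro x hx
    have hqx := (hq1.contDiffAt (hΩo.mem_nhds hx)).differentiableAt one_ne_zero
    rw [divergence_smul ((hT.contDiffAt (hΩo.mem_nhds hx)).differentiableAt one_ne_zero)
      ((hu1.contDiffAt (hΩo.mem_nhds hx)).differentiableAt one_ne_zero)]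
    have h1 := ((hasDerivAt_softTruncation ε (q x)).comp_hasFDerivAt x hqx.hasFDerivAt).fderiv
    rw [show (fun x => softTruncation ε (q x)) = softTruncation ε ∘ q from rfl, h1]
    simp
  have hqm : ContinuousOn q Ω := hq1.continuousOn
  have hint : IntegrableOn (fun x => softTruncation ε (q x) * divergence u x +
      (1 - (ε * q x) ^ 2) / (1 + (ε * q x) ^ 2) ^ 2 * fderiv ℝ q x (u x)) Ω := by
    refine Integrable.add ?_ ?_
    · refine hdiv.bdd_mul (c := ε⁻¹) (hT.continuousOn.aestronglyMeasurable hΩo.measurableSet)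
        (.of_forall fun x => abs_softTruncation_le hε _)
    · refine hqu.bdd_mul (c := 1) (ContinuousOn.aestronglyMeasurable ?_ hΩo.measurableSet)
        (.of_forall fun x => abs_deriv_softTruncation_le ε _)
      refine ContinuousOn.div (by fun_prop) (by fun_prop) fun x _ => by positivity
  refine ⟨hint, ?_⟩
  rw [← integral_divergence_smul_eq_zero hΩo hΩ hS (hT.smul hu1) ?_
    (hint.congr_fun (fun x hx => (hdivT x hx).symm) hΩo.measurableSet) hu hun
    fun x _ => abs_softTruncation_le hε (q x)]
  · exact setIntegral_congr_fun hΩo.measurableSet fun x hx => (hdivT x hx).symm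
  · refine (hu2.const_smul ε⁻¹ : MemLp (fun x => ε⁻¹ • u x) 2 _).mono
      ((hT.smul hu1).continuousOn.aestronglyMeasurable hΩo.measurableSet) (.of_forall fun x => ?_)
    rw [norm_smul, Pi.smul_apply, norm_smul, Real.norm_of_nonneg (inv_nonneg.2 hε.le)]
    exact mul_le_mul_of_nonneg_right (abs_softTruncation_le hε _) (norm_nonneg _)

/-- Integration by parts for two fields with opposite divergences, tangent to the boundary. -/
theorem integral_pressure_power_eq_zero {Ω : Set (E n)} (hΩo : IsOpen Ω)
    (hΩ : Bornology.IsBounded Ω) (hS : HasPiecewiseSmoothBoundary Ω)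
    {u : Fin 2 → E n → E n} {q : Fin 2 → E n → ℝ}
    (hu1 : ∀ i, ContDiffOn ℝ 1 (u i) Ω) (hq1 : ∀ i, ContDiffOn ℝ 1 (q i) Ω)
    (hu2 : ∀ i, MemLp (u i) 2 (volume.restrict Ω))
    (hdiv : ∀ i, IntegrableOn (divergence (u i)) Ω)
    (hqu : ∀ i, IntegrableOn (fun x => fderiv ℝ (q i) x (u i x)) Ω)
    (hu : ∀ i, ContinuousOn (u i) (Ω ∪ regularBoundary Ω))
    (hun : ∀ i x ν, IsOutwardUnitNormal Ω x ν → ⟪u i x, ν⟫ = 0)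
    (hmass : ∀ x ∈ Ω, divergence (u 0) x + divergence (u 1) x = 0)
    (hpq : IntegrableOn (fun x => (q 0 x - q 1 x) * divergence (u 0) x) Ω) :
    (∫ x in Ω, (q 0 x - q 1 x) * divergence (u 0) x) + (∫ x in Ω, fderiv ℝ (q 0) x (u 0 x)) +
      ∫ x in Ω, fderiv ℝ (q 1) x (u 1 x) = 0 := by
  let ε : ℕ → ℝ := fun k => 1 / ((k : ℝ) + 1)
  have hε : ∀ k, 0 < ε k := fun k => Nat.one_div_pos_of_nat
  have hεlim : Tendsto ε atTop (𝓝 0) := tendsto_one_div_add_atTop_nhds_zero_nat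
  let T' : ℝ → ℝ → ℝ := fun ε s => (1 - (ε * s) ^ 2) / (1 + (ε * s) ^ 2) ^ 2
  let J : ℕ → Fin 2 → E n → ℝ := fun k i x => softTruncation (ε k) (q i x) * divergence (u i) x +
      T' (ε k) (q i x) * fderiv ℝ (q i) x (u i x)
  have hJ : ∀ k i, IntegrableOn (J k i) Ω ∧ ∫ x in Ω, J k i x = 0 := fun k i =>
    integral_softTruncation_eq_zero hΩo hΩ hS (hu1 i) (hq1 i) (hu2 i) (hdiv i) (hqu i) (hu i)
      (hun i) (hε k)
  have hJ0 : ∀ k, ∫ x in Ω, (J k 0 x + J k 1 x) = 0 := fun k => by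
    rw [integral_add (hJ k 0).1 (hJ k 1).1, (hJ k 0).2, (hJ k 1).2, add_zero]
  -- The two networks are combined before the limit: a single `q i * div (u i)` need not be
  -- integrable, but opposite divergences leave only `q 0 - q 1`.
  have hJeq : ∀ k, ∀ x ∈ Ω, J k 0 x + J k 1 x =
      (softTruncation (ε k) (q 0 x) - softTruncation (ε k) (q 1 x)) * divergence (u 0) x +
      T' (ε k) (q 0 x) * fderiv ℝ (q 0) x (u 0 x) +
      T' (ε k) (q 1 x) * fderiv ℝ (q 1) x (u 1 x) := by
    intro k x hx
    simp only [J]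
    rw [eq_neg_of_add_eq_zero_right (hmass x hx)]
    ring
  have hlim : Tendsto (fun k => ∫ x in Ω, (J k 0 x + J k 1 x)) atTop
      (𝓝 (∫ x in Ω, ((q 0 x - q 1 x) * divergence (u 0) x + fderiv ℝ (q 0) x (u 0 x) +
        fderiv ℝ (q 1) x (u 1 x)))) := by
    refine tendsto_integral_of_dominated_convergence
      (fun x => |(q 0 x - q 1 x) * divergence (u 0) x| + |fderiv ℝ (q 0) x (u 0 x)| +
        |fderiv ℝ (q 1) x (u 1 x)|)
      (fun k => ((hJ k 0).1.add (hJ k 1).1).aestronglyMeasurable)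
      ((hpq.abs.add (hqu 0).abs).add (hqu 1).abs)
      (fun k => (ae_restrict_iff' hΩo.measurableSet).2 (.of_forall fun x hx => ?_))
      ((ae_restrict_iff' hΩo.measurableSet).2 (.of_forall fun x hx => ?_))
    · rw [hJeq k x hx]
      refine (norm_add₃_le).trans (add_le_add (add_le_add ?_ ?_) ?_)
      · rw [Real.norm_eq_abs, abs_mul, abs_mul]
        exact mul_le_mul_of_nonneg_right (abs_softTruncation_sub_le _ _ _) (abs_nonneg _)
      · rw [Real.norm_eq_abs, abs_mul]
        exact mul_le_of_le_one_left (abs_nonneg _) (abs_deriv_softTruncation_le _ _)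
      · rw [Real.norm_eq_abs, abs_mul]
        exact mul_le_of_le_one_left (abs_nonneg _) (abs_deriv_softTruncation_le _ _)
    · simp_rw [hJeq _ x hx]
      have hT : ∀ i, Tendsto (fun k => softTruncation (ε k) (q i x)) atTop (𝓝 (q i x)) :=
        fun i => (tendsto_softTruncation _).comp hεlim
      have hT' : ∀ i, Tendsto (fun k => T' (ε k) (q i x)) atTop (𝓝 1) :=
        fun i => (tendsto_deriv_softTruncation _).comp hεlim
      simpa using ((((hT 0).sub (hT 1)).mul_const (divergence (u 0) x)).add
        ((hT' 0).mul_const (fderiv ℝ (q 0) x (u 0 x)))).add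
        ((hT' 1).mul_const (fderiv ℝ (q 1) x (u 1 x)))
  simp_rw [hJ0] at hlim
  have := tendsto_nhds_unique hlim tendsto_const_nhds
  have hi : IntegrableOn
      (fun x => (q 0 x - q 1 x) * divergence (u 0) x + fderiv ℝ (q 0) x (u 0 x)) Ω :=
    hpq.add (hqu 0)
  rwa [integral_add hi (hqu 1), integral_add hpq (hqu 0)] at this

/-! ### Convexity of the dissipation and vanishing of its first variation. -/

namespace Problem

variable (D : Problem n)

theorem isPositive_drag (i : Fin 2) {x : E n} (hx : x ∈ D.Ω) :
    (Matrix.toEuclideanLin (D.α i x)).IsPositive := by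
  rw [Matrix.isPositive_toEuclideanLin_iff]
  have hφ := D.φ_pos i x hx
  have hμ := D.μ_pos
  exact (D.K_posDef i x hx).inv.posSemidef.smul (by positivity)

theorem drag_inner_comm (i : Fin 2) {x : E n} (hx : x ∈ D.Ω) (a b : E n) :
    ⟪D.drag i x a, b⟫ = ⟪D.drag i x b, a⟫ := by
  rw [real_inner_comm a (D.drag i x b)]
  exact (D.isPositive_drag i hx).isSymmetric a b

theorem drag_inner_nonneg (i : Fin 2) {x : E n} (hx : x ∈ D.Ω) (a : E n) :
    0 ≤ ⟪D.drag i x a, a⟫ := by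
  simpa [drag] using (D.isPositive_drag i hx).re_inner_nonneg_left a

theorem drag_inner_sub_sub (i : Fin 2) {x : E n} (hx : x ∈ D.Ω) (a b : E n) :
    ⟪D.drag i x (a - b), a - b⟫ =
      ⟪D.drag i x a, a⟫ - 2 * ⟪D.drag i x b, a⟫ + ⟪D.drag i x b, b⟫ := by
  have h1 : D.drag i x (a - b) = D.drag i x a - D.drag i x b := map_sub _ _ _
  rw [h1, inner_sub_left, inner_sub_right, inner_sub_right, D.drag_inner_comm i hx a b]
  ring

theorem drag_inner_add_add (i : Fin 2) {x : E n} (hx : x ∈ D.Ω) (a b : E n) :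
    ⟪D.drag i x (a + b), a + b⟫ =
      ⟪D.drag i x a, a⟫ + 2 * ⟪D.drag i x b, a⟫ + ⟪D.drag i x b, b⟫ := by
  have h1 : D.drag i x (a + b) = D.drag i x a + D.drag i x b := map_add _ _ _
  rw [h1, inner_add_left, inner_add_right, inner_add_right, D.drag_inner_comm i hx a b]
  ring

/-- The dissipation rate lies above its tangents. -/
theorem drag_inner_add_two_mul_le (i : Fin 2) {x : E n} (hx : x ∈ D.Ω) (v w : E n) :
    ⟪D.drag i x v, v⟫ + 2 * ⟪D.drag i x v, w - v⟫ ≤ ⟪D.drag i x w, w⟫ := by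
  have h1 := D.drag_inner_nonneg i hx (w - v)
  rw [D.drag_inner_sub_sub i hx] at h1
  rw [inner_sub_right]
  linarith

/-- Nonnegativity of the quadratic form at `w - v` and `w + v` bounds the mixed term by the two
dissipation rates; this makes the cross term integrable. -/
theorem abs_drag_inner_sub_le (i : Fin 2) {x : E n} (hx : x ∈ D.Ω) (v w : E n) :
    |⟪D.drag i x v, w - v⟫| ≤ 2 * ⟪D.drag i x v, v⟫ + ⟪D.drag i x w, w⟫ := by
  have h1 := D.drag_inner_nonneg i hx (w - v)
  have h2 := D.drag_inner_nonneg i hx (w + v)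
  have h3 := D.drag_inner_nonneg i hx v
  have h4 := D.drag_inner_nonneg i hx w
  rw [D.drag_inner_sub_sub i hx] at h1
  rw [D.drag_inner_add_add i hx] at h2
  rw [inner_sub_right, abs_le]
  constructor <;> linarith

variable {D}

theorem IsSolution.isKinematicallyAdmissible {v : Fin 2 → E n → E n} {p : Fin 2 → E n → ℝ}
    (h : D.IsSolution v p) : D.IsKinematicallyAdmissible v := by
  obtain ⟨hvel, -, -, hm₀, hm₁, hn, -⟩ := h
  exact ⟨hvel, fun x hx => by rw [hm₀ x hx, hm₁ x hx, add_neg_cancel], hn⟩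

/-- The drag of the true velocities derives from the pressure corrected by the force potential. -/
theorem IsSolution.fderiv_pressure_add_potential {v : Fin 2 → E n → E n} {p : Fin 2 → E n → ℝ}
    (h : D.IsSolution v p) {ψ : E n → ℝ} (hψ : ContDiffOn ℝ 1 ψ D.Ω)
    (hb : ∀ x ∈ D.Ω, D.γ • D.b x = -gradient ψ x) (i : Fin 2) {x : E n} (hx : x ∈ D.Ω)
    (z : E n) :
    fderiv ℝ (fun y => p i y + ψ y) x (D.φ i x • z) = -⟪D.drag i x (v i x), z⟫ := by
  have hn := D.isOpen_Ω.mem_nhds hx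
  rw [fderiv_fun_add (((h.pressure i).contDiffOn.contDiffAt hn).differentiableAt one_ne_zero)
    ((hψ.contDiffAt hn).differentiableAt one_ne_zero)]
  have h1 : D.drag i x (v i x) = D.φ i x • -gradient ψ x - D.φ i x • gradient (p i) x := by
    rw [← hb x hx, smul_smul, eq_sub_iff_add_eq]
    exact h.momentum i x hx
  rw [h1, inner_sub_left, inner_smul_left, inner_smul_left, inner_neg_left, inner_gradient_left,
    inner_gradient_left]
  simp
  ring

theorem dissipation_le_of_isSolution {v w : Fin 2 → E n → E n} {p : Fin 2 → E n → ℝ}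
    (hΓ : ∀ i, D.Γv i = frontier D.Ω) (hb : D.HasConservativeBodyForce)
    (hv : D.IsSolution v p) (hw : D.IsKinematicallyAdmissible w) :
    D.dissipation v ≤ D.dissipation w := by
  obtain ⟨ψ, hψ, hψb⟩ := hb
  have hva := hv.isKinematicallyAdmissible
  have hΩm := D.isOpen_Ω.measurableSet
  have hreg : ∀ i, D.Γv i ∩ regularBoundary D.Ω = regularBoundary D.Ω := fun i => by
    rw [hΓ i, inter_eq_right]
    rintro x ⟨ν, hν⟩
    exact hν.1
  have hfin : IsFiniteMeasure (volume.restrict D.Ω) :=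
    isFiniteMeasure_restrict.2 D.isBounded_Ω.measure_lt_top.ne
  have hμβ : 0 < D.μ / D.β := div_pos D.μ_pos D.β_pos
  let q : Fin 2 → E n → ℝ := fun i x => p i x + ψ x
  let u : Fin 2 → E n → E n := fun i x => D.discharge i (w i) x - D.discharge i (v i) x
  have huφ : ∀ i x, u i x = D.φ i x • (w i x - v i x) := fun i x => (smul_sub _ _ _).symm
  have hdiff : ∀ {f : E n → E n}, ContDiffOn ℝ 1 f D.Ω → ∀ x ∈ D.Ω, DifferentiableAt ℝ f x :=
    fun hf x hx => (hf.contDiffAt (D.isOpen_Ω.mem_nhds hx)).differentiableAt one_ne_zero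
  have hdivu : ∀ i, ∀ x ∈ D.Ω, divergence (u i) x =
      divergence (D.discharge i (w i)) x - divergence (D.discharge i (v i)) x := fun i x hx =>
    divergence_sub (hdiff (hw.velocity i).contDiffOn x hx) (hdiff (hv.velocity i).contDiffOn x hx)
  have hu1 : ∀ i, ContDiffOn ℝ 1 (u i) D.Ω := fun i =>
    (hw.velocity i).contDiffOn.sub (hv.velocity i).contDiffOn
  have hq1 : ∀ i, ContDiffOn ℝ 1 (q i) D.Ω := fun i => (hv.pressure i).contDiffOn.add hψ
  have hdivu2 : ∀ i, MemLp (divergence (u i)) 2 (volume.restrict D.Ω) := fun i =>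
    ((hw.velocity i).memLp_div.sub (hv.velocity i).memLp_div).ae_eq
      ((ae_restrict_iff' hΩm).2 (.of_forall fun x hx => (hdivu i x hx).symm))
  have hpow : ∀ i, ∀ x ∈ D.Ω, fderiv ℝ (q i) x (u i x) =
      -⟪D.drag i x (v i x), w i x - v i x⟫ := fun i x hx => by
    rw [huφ]
    exact hv.fderiv_pressure_add_potential hψ hψb i hx _
  have hqu : ∀ i, IntegrableOn (fun x => fderiv ℝ (q i) x (u i x)) D.Ω := fun i => by
    refine (((hv.velocity i).integrableOn.const_mul 2).add (hw.velocity i).integrableOn).mono'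
      ((((hq1 i).continuousOn_fderiv_of_isOpen D.isOpen_Ω le_rfl).clm_apply
        (hu1 i).continuousOn).aestronglyMeasurable hΩm)
      ((ae_restrict_iff' hΩm).2 (.of_forall fun x hx => ?_))
    rw [hpow i x hx, norm_neg]
    exact D.abs_drag_inner_sub_le i hx _ _
  -- Integrability is read off from `dq i (u i)`, which is continuous in the domain, as no
  -- measurability of `K i` is assumed.
  have hX : ∀ i, IntegrableOn (fun x => ⟪D.drag i x (v i x), w i x - v i x⟫) D.Ω := fun i =>
    (hqu i).neg.congr_fun (fun x hx => by simp [hpow i x hx]) hΩm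
  let dv : E n → ℝ := divergence (D.discharge 0 (v 0))
  let dw : E n → ℝ := divergence (D.discharge 0 (w 0))
  have hdv : MemLp dv 2 (volume.restrict D.Ω) := (hv.velocity 0).memLp_div
  have hdw : MemLp dw 2 (volume.restrict D.Ω) := (hw.velocity 0).memLp_div
  have hvv : IntegrableOn (fun x => dv x * dv x) D.Ω := hdv.integrable_mul hdv
  have hww : IntegrableOn (fun x => dw x * dw x) D.Ω := hdw.integrable_mul hdw
  have hvd : IntegrableOn (fun x => dv x * (dw x - dv x)) D.Ω := hdv.integrable_mul (hdw.sub hdv)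
  obtain ⟨-, -, -, hm₀, -, -, -⟩ := id hv
  -- The potential `ψ` cancels in `q 0 - q 1`, and the mass transfer law expresses the pressure
  -- difference through `dv`.
  have hjump : ∀ x ∈ D.Ω, (q 0 x - q 1 x) * divergence (u 0) x =
      -(D.μ / D.β) * (dv x * (dw x - dv x)) := fun x hx => by
    have h1 : dv x = -(D.β / D.μ) * (p 0 x - p 1 x) := hm₀ x hx
    have h2 : q 0 x - q 1 x = -(D.μ / D.β) * dv x := by
      have h3 := D.μ_pos.ne'
      have h4 := D.β_pos.ne'
      rw [h1]
      simp only [q]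
      field_simp
      ring
    rw [h2, hdivu 0 x hx, mul_assoc]
  have hkey := integral_pressure_power_eq_zero D.isOpen_Ω D.isBounded_Ω D.piecewiseSmooth_Ω
    hu1 hq1 (fun i => (hw.velocity i).memLp.sub (hv.velocity i).memLp)
    (fun i => (hdivu2 i).integrable one_le_two) hqu
    (fun i => by
      have := (hw.velocity i).continuousOn.sub (hv.velocity i).continuousOn
      rwa [hreg i] at this)
    (fun i x ν hν => by
      have hx : x ∈ D.Γv i := by rw [hΓ i]; exact hν.1
      rw [huφ, inner_smul_left, inner_sub_left, hw.normal_velocity i x hx ν hν,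
        hv.normal_velocity i x hx ν hν, sub_self, mul_zero])
    (fun x hx => by
      rw [hdivu 0 x hx, hdivu 1 x hx]
      linarith [hw.mass x hx, hva.mass x hx])
    (IntegrableOn.congr_fun (hvd.const_mul _) (fun x hx => (hjump x hx).symm) hΩm)
  rw [setIntegral_congr_fun hΩm hjump, integral_const_mul, setIntegral_congr_fun hΩm (hpow 0),
    setIntegral_congr_fun hΩm (hpow 1), integral_neg, integral_neg] at hkey
  have hdrag : ∀ i, (∫ x in D.Ω, ⟪D.drag i x (v i x), v i x⟫) +
      2 * ∫ x in D.Ω, ⟪D.drag i x (v i x), w i x - v i x⟫ ≤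
      ∫ x in D.Ω, ⟪D.drag i x (w i x), w i x⟫ := fun i => by
    rw [← integral_const_mul, ← integral_add (hv.velocity i).integrableOn ((hX i).const_mul 2)]
    exact setIntegral_mono_on ((hv.velocity i).integrableOn.add ((hX i).const_mul 2))
      (hw.velocity i).integrableOn hΩm fun x hx => D.drag_inner_add_two_mul_le i hx _ _
  have htransfer : (∫ x in D.Ω, dv x * dv x) + 2 * ∫ x in D.Ω, dv x * (dw x - dv x) ≤
      ∫ x in D.Ω, dw x * dw x := by
    rw [← integral_const_mul, ← integral_add hvv (hvd.const_mul 2)]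
    refine setIntegral_mono_on (hvv.add (hvd.const_mul 2)) hww hΩm fun x _ => ?_
    nlinarith [sq_nonneg (dw x - dv x)]
  -- Opposite divergences have equal squares, so the two halves in the functional add up to one
  -- macro-pore integral.
  have hmicro : ∀ {z : Fin 2 → E n → E n}, D.IsKinematicallyAdmissible z →
      ∫ x in D.Ω, D.μ / D.β * (divergence (D.discharge 1 (z 1)) x *
        divergence (D.discharge 1 (z 1)) x) =
      ∫ x in D.Ω, D.μ / D.β * (divergence (D.discharge 0 (z 0)) x *
        divergence (D.discharge 0 (z 0)) x) := fun hz =>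
    setIntegral_congr_fun hΩm fun x hx => by
      rw [eq_neg_of_add_eq_zero_right (hz.mass x hx), neg_mul_neg]
  unfold dissipation
  rw [Fin.sum_univ_two, Fin.sum_univ_two, hmicro hva, hmicro hw, integral_const_mul,
    integral_const_mul]
  -- Adding the three tangent inequalities, the linear terms sum to zero by `hkey`.
  have h1 := hdrag 0
  have h2 := hdrag 1
  have h3 := mul_le_mul_of_nonneg_left htransfer hμβ.le
  simp only [dv, dw] at h3 hkey
  linarith

end Problem

end DoublePorosity

theorem mainTheorem3 {n : ℕ} (D : DoublePorosity.Problem n)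
    (hΓ : ∀ i, D.Γv i = frontier D.Ω)
    (hb : D.HasConservativeBodyForce)
    (v : Fin 2 → DoublePorosity.E n → DoublePorosity.E n)
    (hv : D.IsTrueVelocityPair v) :
    D.IsKinematicallyAdmissible v ∧
      ∀ w : Fin 2 → DoublePorosity.E n → DoublePorosity.E n,
        D.IsKinematicallyAdmissible w → D.dissipation v ≤ D.dissipation w := by
  obtain ⟨p, hp⟩ := hv
  exact ⟨hp.isKinematicallyAdmissible,
    fun w hw => DoublePorosity.Problem.dissipation_le_of_isSolution hΓ hb hp hw⟩
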